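/- Let $X$ be a completely regular Hausdorff space and let $C(X)$ be the ring of all continuous real-valued functions on $X$. Let $Q(X)$ denote the maximal ring of quotients of $C(X)$, that is, $Q(X)=\varinjlim_D \operatorname{Hom}_{C(X)}(D,C(X))$, where $D$ runs over the ideals of $C(X)$ whose only annihilator in $C(X)$ is $0$, homomorphisms are identified when they agree on the common part of their domains, and multiplication is composition. As a $C(X)$-algebra, $Q(X)$ is isomorphic to the ring $\varinjlim_V C(V)$ of all continuous real-valued functions on the dense open subsets $V$ of $X$ (two functions being identified when they agree on the common part of their domains); identify $Q(X)$ with this ring, let $Q^*(X)$ be its subring of bounded functions, and give $Q(X)$ the metric $(f,g)\mapsto \sup_x \frac{|f(x)-g(x)|}{1+|f(x)-g(x)|}$. Let $\overline{Q}(X)$ be the metric completion of $Q(X)$, realized as the ring of all continuous real-valued functions on the dense $G_\delta$ subsets of the Stone-Čech compactification $\beta X$ (with the analogous identification and metric): this ring is metrically complete, and there is an isometric ring homomorphism of $Q(X)$ onto a dense subring of it. Let $\overline{Q}^*(X)$ be the subring of bounded functions in $\overline{Q}(X)$. Let $E(Q(X))$ be the Boolean ring of all idempotents of $Q(X)$,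 with the multiplication of $Q(X)$ and the addition $(e,f)\mapsto e+f-2ef$. Then the maximal ideal spaces (the sets of maximal ideals with the topology having as a base the sets $\{M : a\notin M\}$, $a$ in the ring) of $Q(X)$, $Q^*(X)$, $\overline{Q}(X)$, $\overline{Q}^*(X)$ and $E(Q(X))$ are all homeomorphic. -/

import Mathlib

open Set Topology

noncomputable section

namespace RingsOfQuotients

universe u

/-! ### The maximal ring of quotients of a commutative ring -/

section MaximalQuotients

variable {A : Type u} [CommRing A]

/-- An ideal is (rationally) dense if its only annihilator in the ring is `0`. -/
def IsDenseIdeal (D : Ideal A) : Prop :=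
  ∀ a : A, (∀ d ∈ D, a * d = 0) → a = 0

theorem isDenseIdeal_top : IsDenseIdeal (⊤ : Ideal A) := fun a h => by
  simpa using h 1 trivial

theorem IsDenseIdeal.mul {D E : Ideal A} (hD : IsDenseIdeal D) (hE : IsDenseIdeal E) :
    IsDenseIdeal (D * E) := fun a h =>
  hD a fun d hd => hE _ fun e he => by
    rw [mul_assoc]; exact h _ (Ideal.mul_mem_mul hd he)

theorem IsDenseIdeal.inf {D E : Ideal A} (hD : IsDenseIdeal D) (hE : IsDenseIdeal E) :
    IsDenseIdeal (D ⊓ E) := fun a h =>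
  hD.mul hE a fun d hd => h d (Ideal.mul_le_inf hd)

variable (A) in
/-- The elements of `Hom D = Hom_A(D, A)`, with `D` running over the dense ideals of `A`. -/
structure DenseHom where
  dom : Ideal A
  dense : IsDenseIdeal dom
  hom : dom →ₗ[A] A

namespace DenseHom

theorem hom_mul_comm (φ : DenseHom A) {x y : A} (hx : x ∈ φ.dom) (hy : y ∈ φ.dom) :
    x * φ.hom ⟨y, hy⟩ = y * φ.hom ⟨x, hx⟩ := by
  rw [← smul_eq_mul, ← smul_eq_mul, ← map_smul, ← map_smul]
  congr 1
  ext
  simp [mul_comm]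

/-- Two homomorphisms on dense ideals are identified if they agree on the common part of their
domains. -/
def Rel (φ ψ : DenseHom A) : Prop :=
  ∀ (x : A) (hx : x ∈ φ.dom) (hx' : x ∈ ψ.dom), φ.hom ⟨x, hx⟩ = ψ.hom ⟨x, hx'⟩

/-- It suffices that they agree on a set with zero annihilator. -/
theorem Rel.of_set {φ ψ : DenseHom A} (s : Set A) (hs : ∀ a : A, (∀ x ∈ s, a * x = 0) → a = 0)
    (h : ∀ x ∈ s, ∃ (hx : x ∈ φ.dom) (hx' : x ∈ ψ.dom), φ.hom ⟨x, hx⟩ = ψ.hom ⟨x, hx'⟩) :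
    Rel φ ψ := fun y hy hy' => by
  refine sub_eq_zero.mp (hs _ fun x hx => ?_)
  obtain ⟨h1, h2, h3⟩ := h x hx
  rw [sub_mul, mul_comm, φ.hom_mul_comm h1 hy, h3, mul_comm (ψ.hom _), ψ.hom_mul_comm h2 hy',
    sub_self]

variable (A) in
instance setoid : Setoid (DenseHom A) where
  r := Rel
  iseqv :=
    { refl := fun _ _ _ _ => rfl
      symm := fun h x hx hx' => (h x hx' hx).symm
      trans := fun {φ ψ χ} h h' =>
        Rel.of_set ((φ.dom ⊓ ψ.dom ⊓ χ.dom : Ideal A) : Set A)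
          ((φ.dense.inf ψ.dense).inf χ.dense) fun x hx =>
          ⟨hx.1.1, hx.2, (h x hx.1.1 hx.1.2).trans (h' x hx.1.2 hx.2)⟩ }

/-- An element `a` of `A`, regarded as the mapping `x ↦ a * x` on `A`. -/
def ofElem (a : A) : DenseHom A where
  dom := ⊤
  dense := isDenseIdeal_top
  hom := a • Submodule.subtype _

/-- The sum, defined on the intersection of the domains. -/
def add (φ ψ : DenseHom A) : DenseHom A where
  dom := φ.dom ⊓ ψ.dom
  dense := φ.dense.inf ψ.dense
  hom := φ.hom ∘ₗ Submodule.inclusion inf_le_left + ψ.hom ∘ₗ Submodule.inclusion inf_le_right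

/-- The negative. -/
def neg (φ : DenseHom A) : DenseHom A where
  dom := φ.dom
  dense := φ.dense
  hom := -φ.hom

theorem hom_mem_of_mem_mul (φ : DenseHom A) {D : Ideal A} {x : A} (hx : x ∈ D * φ.dom)
    (hx' : x ∈ φ.dom) : φ.hom ⟨x, hx'⟩ ∈ D := by
  have key : ∃ h : x ∈ φ.dom, φ.hom ⟨x, h⟩ ∈ D := by
    induction hx using Submodule.mul_induction_on' with
    | mem_mul_mem d hd e he =>
      refine ⟨φ.dom.mul_mem_left d he, ?_⟩
      have h : φ.hom (d • ⟨e, he⟩) = d * φ.hom ⟨e, he⟩ := φ.hom.map_smul d ⟨e, he⟩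
      exact h ▸ D.mul_mem_right _ hd
    | add x hx y hy h1 h2 =>
      obtain ⟨h1, h1'⟩ := h1
        (Ideal.mul_le_right hx)
      obtain ⟨h2, h2'⟩ := h2
        (Ideal.mul_le_right hy)
      refine ⟨φ.dom.add_mem h1 h2, ?_⟩
      have h : φ.hom (⟨x, h1⟩ + ⟨y, h2⟩) = φ.hom ⟨x, h1⟩ + φ.hom ⟨y, h2⟩ := φ.hom.map_add _ _
      exact h ▸ D.add_mem h1' h2'
  exact key.2

/-- The product is the composition `φ ∘ ψ`, defined on the product of the domains. -/
def mul (φ ψ : DenseHom A) : DenseHom A where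
  dom := φ.dom * ψ.dom
  dense := φ.dense.mul ψ.dense
  hom := φ.hom ∘ₗ LinearMap.codRestrict φ.dom (ψ.hom ∘ₗ Submodule.inclusion Ideal.mul_le_right)
    fun x => ψ.hom_mem_of_mem_mul x.2 _

theorem add_hom (φ ψ : DenseHom A) {x : A} (hx : x ∈ φ.dom) (hx' : x ∈ ψ.dom) :
    (add φ ψ).hom ⟨x, hx, hx'⟩ = φ.hom ⟨x, hx⟩ + ψ.hom ⟨x, hx'⟩ := rfl

theorem mul_hom (φ ψ : DenseHom A) {d e x : A} (hd : d ∈ φ.dom) (he : e ∈ ψ.dom)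
    (hx : x = d * e) :
    ∃ h : x ∈ (mul φ ψ).dom, (mul φ ψ).hom ⟨x, h⟩ = φ.hom ⟨d, hd⟩ * ψ.hom ⟨e, he⟩ := by
  subst hx
  have h : ψ.hom ⟨d * e, ψ.dom.mul_mem_left d he⟩ = d * ψ.hom ⟨e, he⟩ :=
    ψ.hom.map_smul d ⟨e, he⟩
  have h2 : φ.hom ⟨d * ψ.hom ⟨e, he⟩, φ.dom.mul_mem_right _ hd⟩ =
      φ.hom ⟨d, hd⟩ * ψ.hom ⟨e, he⟩ := by
    rw [mul_comm (φ.hom _), ← smul_eq_mul (ψ.hom _), ← map_smul]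
    congr 1
    ext
    simp [mul_comm]
  refine ⟨Ideal.mul_mem_mul hd he, ?_⟩
  rw [← h2]
  show φ.hom _ = φ.hom _
  congr 1
  ext
  exact h

end DenseHom

variable (A) in
/-- The maximal ring of quotients `𝒬(A)` of a commutative ring: the direct limit of the modules
`Hom D` over all dense ideals `D` of `A`, with composition as multiplication. -/
def MaxQuot : Type u := Quotient (DenseHom.setoid A)

namespace MaxQuot

open DenseHom

/-- The class of a homomorphism on a dense ideal. -/
def mk (φ : DenseHom A) : MaxQuot A := Quotient.mk _ φ

theorem mk_eq_of_set {φ ψ : DenseHom A} (s : Set A)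
    (hs : ∀ a : A, (∀ x ∈ s, a * x = 0) → a = 0)
    (h : ∀ x ∈ s, ∃ (hx : x ∈ φ.dom) (hx' : x ∈ ψ.dom), φ.hom ⟨x, hx⟩ = ψ.hom ⟨x, hx'⟩) :
    mk φ = mk ψ :=
  Quotient.sound (Rel.of_set s hs h)

instance : Zero (MaxQuot A) := ⟨mk (ofElem 0)⟩
instance : One (MaxQuot A) := ⟨mk (ofElem 1)⟩

instance : Add (MaxQuot A) where
  add := Quotient.map₂ add fun _ _ h _ _ h' x hx hx' =>
    congrArg₂ (· + ·) (h x hx.1 hx'.1) (h' x hx.2 hx'.2)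

instance : Neg (MaxQuot A) where
  neg := Quotient.map neg fun _ _ h x hx hx' => congrArg (- ·) (h x hx hx')

theorem prod_set_ann {φ ψ : DenseHom A} (a : A)
    (h : ∀ x ∈ {x : A | ∃ d ∈ φ.dom, ∃ e ∈ ψ.dom, x = d * e}, a * x = 0) : a = 0 :=
  φ.dense a fun d hd => ψ.dense _ fun e he => by
    rw [mul_assoc]; exact h _ ⟨d, hd, e, he, rfl⟩

theorem mk_mul_eq {φ ψ χ : DenseHom A}
    (h : ∀ (d : A) (hd : d ∈ φ.dom) (e : A) (he : e ∈ ψ.dom), ∃ hx : d * e ∈ χ.dom,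
      χ.hom ⟨d * e, hx⟩ = φ.hom ⟨d, hd⟩ * ψ.hom ⟨e, he⟩) :
    mk (mul φ ψ) = mk χ := by
  refine mk_eq_of_set {x | ∃ d ∈ φ.dom, ∃ e ∈ ψ.dom, x = d * e} prod_set_ann ?_
  rintro _ ⟨d, hd, e, he, rfl⟩
  obtain ⟨h1, h2⟩ := mul_hom φ ψ hd he rfl
  obtain ⟨h3, h4⟩ := h d hd e he
  exact ⟨h1, h3, h2.trans h4.symm⟩

instance : Mul (MaxQuot A) where
  mul := Quotient.map₂ mul fun φ φ' h ψ ψ' h' => by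
    refine Rel.of_set {x | ∃ d ∈ (add φ φ').dom, ∃ e ∈ (add ψ ψ').dom, x = d * e}
      prod_set_ann ?_
    rintro _ ⟨d, hd, e, he, rfl⟩
    obtain ⟨h1, h2⟩ := mul_hom φ ψ hd.1 he.1 rfl
    obtain ⟨h3, h4⟩ := mul_hom φ' ψ' hd.2 he.2 rfl
    exact ⟨h1, h3, by rw [h2, h4, h d hd.1 hd.2, h' e he.1 he.2]⟩

theorem mk_add (φ ψ : DenseHom A) : mk φ + mk ψ = mk (add φ ψ) := rfl
theorem mk_mul (φ ψ : DenseHom A) : mk φ * mk ψ = mk (mul φ ψ) := rfl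
theorem mk_neg (φ : DenseHom A) : -mk φ = mk (neg φ) := rfl
theorem zero_eq_mk : (0 : MaxQuot A) = mk (ofElem 0) := rfl
theorem one_eq_mk : (1 : MaxQuot A) = mk (ofElem 1) := rfl

theorem ind {p : MaxQuot A → Prop} (h : ∀ φ, p (mk φ)) (a : MaxQuot A) : p a :=
  Quotient.ind h a

theorem mem_ofElem (a x : A) : x ∈ (ofElem a).dom := Submodule.mem_top

theorem ofElem_hom (a x : A) (hx : x ∈ (ofElem a).dom) : (ofElem a).hom ⟨x, hx⟩ = a * x := rfl

theorem mk_ofElem_mul (a : A) {φ χ : DenseHom A}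
    (h : ∀ (x : A) (hx : x ∈ φ.dom), ∃ hx' : x ∈ χ.dom, χ.hom ⟨x, hx'⟩ = a * φ.hom ⟨x, hx⟩) :
    mk (ofElem a) * mk φ = mk χ := by
  refine mk_mul_eq fun d hd e he => ?_
  obtain ⟨h1, h2⟩ := h (d * e) (φ.dom.mul_mem_left d he)
  refine ⟨h1, ?_⟩
  have h3 : φ.hom ⟨d * e, φ.dom.mul_mem_left d he⟩ = d * φ.hom ⟨e, he⟩ :=
    φ.hom.map_smul d ⟨e, he⟩
  rw [h2, h3, ofElem_hom, mul_assoc]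

protected theorem mul_comm' (a b : MaxQuot A) : a * b = b * a := by
  induction a using ind with | _ a
  induction b using ind with | _ b
  refine mk_mul_eq fun d hd e he => ?_
  rw [mul_comm (a.hom _)]
  exact mul_hom b a he hd (mul_comm d e)

protected theorem one_mul' (a : MaxQuot A) : 1 * a = a := by
  induction a using ind with | _ a
  exact mk_ofElem_mul 1 fun x hx => ⟨hx, (one_mul _).symm⟩

protected theorem zero_mul' (a : MaxQuot A) : 0 * a = 0 := by
  induction a using ind with | _ a
  exact mk_ofElem_mul 0 fun x hx => ⟨mem_ofElem 0 x, by rw [ofElem_hom, zero_mul, zero_mul]⟩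

protected theorem left_distrib' (a b c : MaxQuot A) : a * (b + c) = a * b + a * c := by
  induction a using ind with | _ a
  induction b using ind with | _ b
  induction c using ind with | _ c
  refine mk_mul_eq (φ := a) (ψ := add b c) (χ := add (mul a b) (mul a c)) fun d hd e he => ?_
  obtain ⟨h1, h2⟩ := mul_hom a b hd he.1 rfl
  obtain ⟨h3, h4⟩ := mul_hom a c hd he.2 rfl
  exact ⟨⟨h1, h3⟩, by rw [add_hom _ _ h1 h3, add_hom b c he.1 he.2, h2, h4, mul_add]⟩

protected theorem mul_assoc' (a b c : MaxQuot A) : a * b * c = a * (b * c) := by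
  induction a using ind with | _ a
  induction b using ind with | _ b
  induction c using ind with | _ c
  refine mk_eq_of_set (φ := mul (mul a b) c) (ψ := mul a (mul b c))
    {x | ∃ d ∈ a.dom, ∃ e ∈ {y : A | ∃ d ∈ b.dom, ∃ e ∈ c.dom, y = d * e}, x = d * e}
    (fun y h => a.dense y fun d hd => prod_set_ann (φ := b) (ψ := c) _ fun e he => ?_) ?_
  · rw [mul_assoc]
    exact h _ ⟨d, hd, e, he, rfl⟩
  · rintro _ ⟨x, hx, _, ⟨y, hy, z, hz, rfl⟩, rfl⟩
    obtain ⟨h1, h2⟩ := mul_hom a b hx hy rfl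
    obtain ⟨h3, h4⟩ := mul_hom b c hy hz rfl
    obtain ⟨h5, h6⟩ := mul_hom (mul a b) c h1 hz (mul_assoc x y z).symm
    obtain ⟨h7, h8⟩ := mul_hom a (mul b c) hx h3 rfl
    exact ⟨h5, h7, by rw [h6, h8, h2, h4, mul_assoc]⟩

protected theorem zero_add' (a : MaxQuot A) : 0 + a = a := by
  induction a using ind with | _ a
  refine mk_eq_of_set (φ := add (ofElem 0) a) (a.dom : Set A) a.dense fun x hx =>
    ⟨⟨mem_ofElem 0 x, hx⟩, hx, ?_⟩
  rw [add_hom _ _ (mem_ofElem 0 x) hx, ofElem_hom, zero_mul, zero_add]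

protected theorem add_comm' (a b : MaxQuot A) : a + b = b + a := by
  induction a using ind with | _ a
  induction b using ind with | _ b
  exact mk_eq_of_set (φ := add a b) (ψ := add b a) ((a.dom ⊓ b.dom : Ideal A) : Set A)
    (a.dense.inf b.dense) fun x hx =>
      ⟨hx, ⟨hx.2, hx.1⟩, add_comm (a.hom ⟨x, hx.1⟩) (b.hom ⟨x, hx.2⟩)⟩

protected theorem add_assoc' (a b c : MaxQuot A) : a + b + c = a + (b + c) := by
  induction a using ind with | _ a
  induction b using ind with | _ b
  induction c using ind with | _ c
  exact mk_eq_of_set (φ := add (add a b) c) (ψ := add a (add b c))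
    ((a.dom ⊓ b.dom ⊓ c.dom : Ideal A) : Set A)
    ((a.dense.inf b.dense).inf c.dense) fun x hx =>
      ⟨⟨⟨hx.1.1, hx.1.2⟩, hx.2⟩, ⟨hx.1.1, hx.1.2, hx.2⟩,
        add_assoc (a.hom ⟨x, hx.1.1⟩) (b.hom ⟨x, hx.1.2⟩) (c.hom ⟨x, hx.2⟩)⟩

protected theorem neg_add_cancel' (a : MaxQuot A) : -a + a = 0 := by
  induction a using ind with | _ a
  refine mk_eq_of_set (φ := add (neg a) a) (a.dom : Set A) a.dense fun x hx =>
    ⟨⟨hx, hx⟩, mem_ofElem 0 x, ?_⟩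
  exact (neg_add_cancel (a.hom ⟨x, hx⟩)).trans (zero_mul x).symm

instance : CommRing (MaxQuot A) where
  add_assoc := MaxQuot.add_assoc'
  zero_add := MaxQuot.zero_add'
  add_zero a := by rw [MaxQuot.add_comm', MaxQuot.zero_add']
  add_comm := MaxQuot.add_comm'
  neg_add_cancel := MaxQuot.neg_add_cancel'
  mul_assoc := MaxQuot.mul_assoc'
  one_mul := MaxQuot.one_mul'
  mul_one a := by rw [MaxQuot.mul_comm', MaxQuot.one_mul']
  mul_comm := MaxQuot.mul_comm'
  left_distrib := MaxQuot.left_distrib'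
  right_distrib a b c := by
    rw [MaxQuot.mul_comm', MaxQuot.left_distrib', MaxQuot.mul_comm' c, MaxQuot.mul_comm' c]
  zero_mul := MaxQuot.zero_mul'
  mul_zero a := by rw [MaxQuot.mul_comm', MaxQuot.zero_mul']
  nsmul := nsmulRec
  zsmul := zsmulRec

/-- The canonical embedding `A → 𝒬(A)`. -/
def ofRing : A →+* MaxQuot A where
  toFun a := mk (ofElem a)
  map_zero' := rfl
  map_one' := rfl
  map_add' a b := mk_eq_of_set (φ := ofElem (a + b)) (ψ := add (ofElem a) (ofElem b))
    ((⊤ : Ideal A) : Set A) isDenseIdeal_top fun x _ =>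
      ⟨mem_ofElem _ x, ⟨mem_ofElem a x, mem_ofElem b x⟩, add_mul a b x⟩
  map_mul' a b := (mk_ofElem_mul (φ := ofElem b) (χ := ofElem (a * b)) a fun x _ => ⟨mem_ofElem _ x, mul_assoc a b x⟩).symm

instance : Algebra A (MaxQuot A) := ofRing.toAlgebra

end MaxQuot

end MaximalQuotients

/-! ### The idempotents of a commutative ring -/

/-- The Boolean ring `E(A)` of idempotents of a commutative ring `A`: the order is
`e ≤ f ↔ e * f = e`, the product is that of `A`, and the sum is `e + f - 2 * e * f`. -/
abbrev IdempotentRing (A : Type u) [CommRing A] : Type u :=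
  AsBoolRing {e : A // IsIdempotentElem e}

theorem IdempotentRing.coe_mul {A : Type u} [CommRing A] (e f : IdempotentRing A) :
    (ofBoolRing (e * f)).1 = (ofBoolRing e).1 * (ofBoolRing f).1 := rfl

theorem IdempotentRing.coe_add {A : Type u} [CommRing A] (e f : IdempotentRing A) :
    (ofBoolRing (e + f)).1 = (ofBoolRing e).1 + (ofBoolRing f).1 -
      2 * (ofBoolRing e).1 * (ofBoolRing f).1 := by
  have he : (ofBoolRing e).1 * (ofBoolRing e).1 = (ofBoolRing e).1 := (ofBoolRing e).2
  have hf : (ofBoolRing f).1 * (ofBoolRing f).1 = (ofBoolRing f).1 := (ofBoolRing f).2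
  have h : (ofBoolRing (e + f)).1 = (ofBoolRing e).1 * (1 - (ofBoolRing f).1) +
      (ofBoolRing f).1 * (1 - (ofBoolRing e).1) -
      (ofBoolRing e).1 * (1 - (ofBoolRing f).1) *
        ((ofBoolRing f).1 * (1 - (ofBoolRing e).1)) := rfl
  rw [h]
  linear_combination ((ofBoolRing f).1 - (ofBoolRing f).1 ^ 2) * he

/-! ### Rings of continuous functions on a filter base of dense sets -/

/-- A family of dense subsets of `X`, closed under finite intersection. -/
structure DenseFilterBase (X : Type u) [TopologicalSpace X] where
  sets : Set (Set X)
  nonempty : sets.Nonempty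
  dense : ∀ S ∈ sets, Dense S
  inter : ∀ S ∈ sets, ∀ T ∈ sets, S ∩ T ∈ sets

namespace DenseFilterBase

variable {X : Type u} [TopologicalSpace X] (𝒮 : DenseFilterBase X)

/-- The members of the filter base, ordered by reverse inclusion. -/
abbrev Index : Type u := {S : Set X // S ∈ 𝒮.sets}ᵒᵈ

/-- The underlying set of an index. -/
abbrev carrier (i : 𝒮.Index) : Set X := (OrderDual.ofDual i).1

instance : Nonempty 𝒮.Index :=
  let ⟨S, hS⟩ := 𝒮.nonempty
  ⟨OrderDual.toDual ⟨S, hS⟩⟩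

instance : IsDirectedOrder 𝒮.Index where
  directed i j := ⟨OrderDual.toDual ⟨𝒮.carrier i ∩ 𝒮.carrier j,
    𝒮.inter _ (OrderDual.ofDual i).2 _ (OrderDual.ofDual j).2⟩,
    inter_subset_left, inter_subset_right⟩

/-- Restriction of functions `C(S) → C(T)` for `T ⊆ S`. -/
def restrict (i j : 𝒮.Index) (h : i ≤ j) : C(𝒮.carrier i, ℝ) →+* C(𝒮.carrier j, ℝ) :=
  (ContinuousMap.compRightAlgHom ℝ ℝ
    (⟨Set.inclusion h, continuous_inclusion h⟩ : C(𝒮.carrier j, 𝒮.carrier i))).toRingHom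

instance : DirectedSystem (fun i : 𝒮.Index => C(𝒮.carrier i, ℝ)) (𝒮.restrict · · ·) where
  map_self _ _ := rfl
  map_map _ _ _ _ _ _ := rfl

/-- The ring `C[𝒮]`: the direct limit of the rings `C(S)`, `S ∈ 𝒮`. -/
def FunRing : Type u := DirectLimit (fun i : 𝒮.Index => C(𝒮.carrier i, ℝ)) 𝒮.restrict

instance : CommRing 𝒮.FunRing :=
  inferInstanceAs (CommRing (DirectLimit (fun i : 𝒮.Index => C(𝒮.carrier i, ℝ)) 𝒮.restrict))

variable {𝒮}

/-- The element of `C[𝒮]` represented by a continuous function on a member of `𝒮`. -/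
def of (i : 𝒮.Index) (f : C(𝒮.carrier i, ℝ)) : 𝒮.FunRing :=
  (⟦⟨i, f⟩⟧ : DirectLimit (fun i : 𝒮.Index => C(𝒮.carrier i, ℝ)) 𝒮.restrict)

theorem ind {p : 𝒮.FunRing → Prop} (h : ∀ i f, p (of i f)) (a : 𝒮.FunRing) : p a :=
  DirectLimit.induction _ h a

theorem ind₂ {p : 𝒮.FunRing → 𝒮.FunRing → Prop} (h : ∀ i f g, p (of i f) (of i g))
    (a b : 𝒮.FunRing) : p a b :=
  DirectLimit.induction₂ _ h a b

theorem ind₃ {p : 𝒮.FunRing → 𝒮.FunRing → 𝒮.FunRing → Prop}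
    (h : ∀ i f g k, p (of i f) (of i g) (of i k)) (a b c : 𝒮.FunRing) : p a b c :=
  DirectLimit.induction₃ _ h a b c

theorem of_restrict (i j : 𝒮.Index) (h : i ≤ j) (f : C(𝒮.carrier i, ℝ)) :
    of j (𝒮.restrict i j h f) = of i f :=
  DirectLimit.mk_apply (F := fun i : 𝒮.Index => C(𝒮.carrier i, ℝ)) (f := 𝒮.restrict) i j f h

theorem of_add (i : 𝒮.Index) (f g : C(𝒮.carrier i, ℝ)) : of i f + of i g = of i (f + g) :=
  DirectLimit.add_def (G := fun i : 𝒮.Index => C(𝒮.carrier i, ℝ)) (f := 𝒮.restrict)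
    i f g

theorem of_mul (i : 𝒮.Index) (f g : C(𝒮.carrier i, ℝ)) : of i f * of i g = of i (f * g) :=
  DirectLimit.mul_def (G := fun i : 𝒮.Index => C(𝒮.carrier i, ℝ)) (f := 𝒮.restrict)
    i f g

theorem of_sub (i : 𝒮.Index) (f g : C(𝒮.carrier i, ℝ)) : of i f - of i g = of i (f - g) :=
  DirectLimit.sub_def (G := fun i : 𝒮.Index => C(𝒮.carrier i, ℝ)) (f := 𝒮.restrict)
    i f g

theorem of_neg (i : 𝒮.Index) (f : C(𝒮.carrier i, ℝ)) : -of i f = of i (-f) := rfl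

theorem of_zero (i : 𝒮.Index) : of i 0 = (0 : 𝒮.FunRing) := (DirectLimit.zero_def i).symm

theorem of_one (i : 𝒮.Index) : of i 1 = (1 : 𝒮.FunRing) := (DirectLimit.one_def i).symm

variable (𝒮) in
/-- The canonical embedding `C(X) → C[𝒮]`, by restriction. -/
def ofContinuous : C(X, ℝ) →+* 𝒮.FunRing where
  toFun f := of (Classical.arbitrary _) (f.restrict _)
  map_zero' := of_zero _
  map_one' := of_one _
  map_add' f g := (of_add _ (f.restrict _) (g.restrict _)).symm
  map_mul' f g := (of_mul _ (f.restrict _) (g.restrict _)).symm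

theorem ofContinuous_eq (i : 𝒮.Index) (f : C(X, ℝ)) :
    𝒮.ofContinuous f = of i (f.restrict (𝒮.carrier i)) := by
  obtain ⟨k, hk, hik⟩ := exists_ge_ge (Classical.arbitrary 𝒮.Index) i
  exact (of_restrict _ k hk _).symm.trans (of_restrict i k hik (f.restrict (𝒮.carrier i)))

instance : Algebra C(X, ℝ) 𝒮.FunRing := 𝒮.ofContinuous.toAlgebra

variable (𝒮) in
/-- The subring `C*[𝒮]` of bounded functions in `C[𝒮]`. -/
def bounded : Subring 𝒮.FunRing where
  carrier := {a | ∃ (i : 𝒮.Index) (f : C(𝒮.carrier i, ℝ)) (r : ℝ),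
    a = of i f ∧ ∀ x, |f x| ≤ r}
  zero_mem' := ⟨Classical.arbitrary _, 0, 0, (of_zero _).symm, fun x => by simp⟩
  one_mem' := ⟨Classical.arbitrary _, 1, 1, (of_one _).symm, fun x => by simp⟩
  add_mem' := by
    rintro _ _ ⟨i, f, r, rfl, hf⟩ ⟨j, g, s, rfl, hg⟩
    obtain ⟨k, hik, hjk⟩ := exists_ge_ge i j
    refine ⟨k, 𝒮.restrict i k hik f + 𝒮.restrict j k hjk g, r + s, ?_, fun x => ?_⟩
    · rw [← of_add]
      exact congrArg₂ (· + ·) (of_restrict i k hik f).symm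
        (of_restrict j k hjk g).symm
    · exact (abs_add_le _ _).trans (add_le_add (hf _) (hg _))
  mul_mem' := by
    rintro _ _ ⟨i, f, r, rfl, hf⟩ ⟨j, g, s, rfl, hg⟩
    obtain ⟨k, hik, hjk⟩ := exists_ge_ge i j
    refine ⟨k, 𝒮.restrict i k hik f * 𝒮.restrict j k hjk g, r * s, ?_, fun x => ?_⟩
    · rw [← of_mul]
      exact congrArg₂ (· * ·) (of_restrict i k hik f).symm
        (of_restrict j k hjk g).symm
    · refine (abs_mul _ _).trans_le (mul_le_mul (hf _) (hg _) (abs_nonneg _) ?_)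
      exact (abs_nonneg _).trans (hf (Set.inclusion hik x))
  neg_mem' := by
    rintro _ ⟨i, f, r, rfl, hf⟩
    exact ⟨i, -f, r, rfl, fun x => (abs_neg _).trans_le (hf x)⟩

/-! The metric `‖ (a - b) / (1 + |a - b|) ‖` on `C[𝒮]`, where `‖·‖` is the sup norm. -/

theorem frac_lt_one (t : ℝ) : |t| / (1 + |t|) < 1 := by
  rw [div_lt_one (by positivity)]; linarith [abs_nonneg t]

theorem frac_nonneg (t : ℝ) : 0 ≤ |t| / (1 + |t|) := by positivity

theorem frac_add (s t : ℝ) :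
    |s + t| / (1 + |s + t|) ≤ |s| / (1 + |s|) + |t| / (1 + |t|) := by
  have h := abs_add_le s t
  have h1 := abs_nonneg s
  have h2 := abs_nonneg t
  have h3 := abs_nonneg (s + t)
  calc |s + t| / (1 + |s + t|) ≤ (|s| + |t|) / (1 + (|s| + |t|)) := by
        rw [div_le_div_iff₀ (by positivity) (by positivity)]; nlinarith
    _ = |s| / (1 + (|s| + |t|)) + |t| / (1 + (|s| + |t|)) := add_div _ _ _
    _ ≤ _ := by
        gcongr <;> linarith

/-- `sup_x |f x| / (1 + |f x|)`, for a continuous function `f` on a member of `𝒮`. -/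
def supFrac (i : 𝒮.Index) (f : C(𝒮.carrier i, ℝ)) : ℝ :=
  ⨆ x : 𝒮.carrier i, |f x| / (1 + |f x|)

theorem supFrac_bdd (i : 𝒮.Index) (f : C(𝒮.carrier i, ℝ)) :
    BddAbove (range fun x : 𝒮.carrier i => |f x| / (1 + |f x|)) :=
  ⟨1, by rintro _ ⟨x, rfl⟩; exact (frac_lt_one _).le⟩

theorem le_supFrac (i : 𝒮.Index) (f : C(𝒮.carrier i, ℝ)) (x : 𝒮.carrier i) :
    |f x| / (1 + |f x|) ≤ supFrac i f :=
  le_ciSup (supFrac_bdd i f) x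

theorem supFrac_nonneg (i : 𝒮.Index) (f : C(𝒮.carrier i, ℝ)) : 0 ≤ supFrac i f :=
  Real.iSup_nonneg fun _ => frac_nonneg _

theorem supFrac_restrict (i j : 𝒮.Index) (h : i ≤ j) (f : C(𝒮.carrier i, ℝ)) :
    supFrac i f = supFrac j (𝒮.restrict i j h f) := by
  apply le_antisymm
  · refine Real.iSup_le (fun x => ?_) (supFrac_nonneg _ _)
    have hd : DenseRange (Set.inclusion h : 𝒮.carrier j → 𝒮.carrier i) := by
      refine IsInducing.subtypeVal.dense_iff.2 fun x => ?_
      have : (Subtype.val '' range (Set.inclusion h : 𝒮.carrier j → 𝒮.carrier i)) =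
          𝒮.carrier j := by
        rw [← range_comp]; exact Subtype.range_coe
      rw [this]
      exact 𝒮.dense _ (OrderDual.ofDual j).2 _
    have hc : IsClosed {x : 𝒮.carrier i |
        |f x| / (1 + |f x|) ≤ supFrac j (𝒮.restrict i j h f)} := by
      refine isClosed_le (Continuous.div (by fun_prop) (by fun_prop) fun x => ?_)
        continuous_const
      positivity
    exact hd.induction_on x hc fun y => le_supFrac j (𝒮.restrict i j h f) y
  · exact Real.iSup_le (fun x => le_supFrac i f (Set.inclusion h x)) (supFrac_nonneg _ _)

/-- `‖ a / (1 + |a|) ‖` for `a` in `C[𝒮]`; it does not depend on the representative. -/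
def size (a : 𝒮.FunRing) : ℝ :=
  DirectLimit.lift 𝒮.restrict supFrac supFrac_restrict a

theorem size_of (i : 𝒮.Index) (f : C(𝒮.carrier i, ℝ)) : size (of i f) = supFrac i f := rfl

theorem size_neg (a : 𝒮.FunRing) : size (-a) = size a := by
  induction a using ind with | _ i f
  simp [of_neg, size_of, supFrac]

theorem size_add (a b : 𝒮.FunRing) : size (a + b) ≤ size a + size b := by
  induction a, b using ind₂ with | _ i f g
  rw [of_add, size_of, size_of, size_of]
  exact Real.iSup_le (fun x => (frac_add (f x) (g x)).trans
    (add_le_add (le_supFrac i f x) (le_supFrac i g x)))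
    (add_nonneg (supFrac_nonneg i f) (supFrac_nonneg i g))

theorem size_zero : size (0 : 𝒮.FunRing) = 0 := by
  rw [← of_zero (Classical.arbitrary _), size_of]
  simp [supFrac]

theorem eq_zero_of_size (a : 𝒮.FunRing) (h : size a = 0) : a = 0 := by
  induction a using ind with | _ i f
  rw [size_of] at h
  rw [← of_zero i]
  congr 1
  ext x
  have h1 := h ▸ le_supFrac i f x
  have h2 : |f x| / (1 + |f x|) = 0 := le_antisymm h1 (frac_nonneg _)
  have h3 : 1 + |f x| ≠ 0 := by positivity
  simpa [h3] using h2

instance : MetricSpace 𝒮.FunRing where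
  dist a b := size (a - b)
  dist_self a := by rw [sub_self, size_zero]
  dist_comm a b := by rw [← size_neg, neg_sub]
  dist_triangle a b c := by
    rw [← sub_add_sub_cancel a b c]
    exact size_add _ _
  eq_of_dist_eq_zero {a b} h := sub_eq_zero.mp (eq_zero_of_size _ h)

theorem dist_of (i : 𝒮.Index) (f g : C(𝒮.carrier i, ℝ)) :
    dist (of i f) (of i g) = ⨆ x, |f x - g x| / (1 + |f x - g x|) := by
  show size (of i f - of i g) = _
  rw [of_sub]
  rfl

end DenseFilterBase

/-! ### The rings attached to a space -/

/-- The dense open subsets of `X`. -/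
def denseOpens (X : Type u) [TopologicalSpace X] : DenseFilterBase X where
  sets := {V | IsOpen V ∧ Dense V}
  nonempty := ⟨univ, isOpen_univ, dense_univ⟩
  dense _ hV := hV.2
  inter _ hV _ hW := ⟨hV.1.inter hW.1, hV.2.inter_of_isOpen_left hW.2 hV.1⟩

/-- The dense `G_δ` subsets of a Baire space `X`. -/
def denseGδs (X : Type u) [TopologicalSpace X] [BaireSpace X] : DenseFilterBase X where
  sets := {S | IsGδ S ∧ Dense S}
  nonempty := ⟨univ, IsGδ.univ, dense_univ⟩
  dense _ hS := hS.2
  inter _ hS _ hT := ⟨hS.1.inter hT.1, hS.2.inter_of_Gδ hS.1 hT.1 hT.2⟩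

/-- `Q(X)`: the maximal ring of quotients of `C(X)`. -/
abbrev Q (X : Type u) [TopologicalSpace X] : Type u := MaxQuot C(X, ℝ)

/-- The realization of `Q(X)` as the ring of all continuous functions on the dense open sets of
`X`, two functions being identified if they agree on the common part of their domains. -/
abbrev QFun (X : Type u) [TopologicalSpace X] : Type u := (denseOpens X).FunRing

/-- `Q*(X)`: the subring of bounded functions in `Q(X)`. -/
abbrev QStar (X : Type u) [TopologicalSpace X] : Subring (QFun X) := (denseOpens X).bounded

/-- The metric completion of `Q(X)`, realized as the ring of all continuous functions on the dense
`G_δ` sets of the Stone–Čech compactification of `X`. -/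
abbrev QBar (X : Type u) [TopologicalSpace X] : Type u := (denseGδs (StoneCech X)).FunRing

/-- The subring of bounded functions in `QBar X`. -/
abbrev QBarStar (X : Type u) [TopologicalSpace X] : Subring (QBar X) :=
  (denseGδs (StoneCech X)).bounded

end RingsOfQuotients

end

open Set Topology

noncomputable section

namespace RingsOfQuotients

universe u

/-! ### Exchange rings and their idempotents -/

/-! All the spaces are compared with the maximal ideal space of one Boolean ring, the idempotents of
`Q X`. In any commutative ring, a maximal ideal meets the idempotents in a maximal ideal of their
Boolean ring, and every maximal ideal of the latter arises so. In an exchange ring the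
correspondence is also injective and a homeomorphism, because idempotents separate comaximal
elements and refine the basic open sets.

The exchange property of `C[𝒮]` comes from cutting along a level of a function. If every dense open
set lies in `𝒮`, one may discard the boundary of the open set `U` where `f > 1/3`. The indicator of
`U` is then continuous; on `U` the function `f` is invertible, off `U` the function `1 - f` is, and
both inverses are bounded. Thus one construction serves `C[𝒮]` and its bounded subring
(`exists_idempotent_factors`).

It remains to see that the rings share their idempotents. `Q X` is identified with `QFun X` by
writing a homomorphism `φ` as multiplication by the quotient `φ(d) / d` on the set where some `d` in
the domain is nonzero. A function on a dense open set of `X` lives on a dense subset of `βX` and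
extends to a dense `G_δ` set, which embeds `QFun X` isometrically in `QBar X`. An idempotent on a
dense `G_δ` set already comes from a dense open set, so no idempotents are gained; bounded subrings
lose none. Approximation by locally constant functions makes the embedding dense, and closure of
dense `G_δ` sets under countable intersections makes `QBar X` complete. -/

/-- A commutative ring is an exchange ring if, for each `a`, some idempotent `e` is a multiple of
`a` while `1 - e` is a multiple of `1 - a`. -/
def IsExchangeRing (B : Type*) [CommRing B] : Prop :=
  ∀ a : B, ∃ e b c : B, e * e = e ∧ e = a * b ∧ 1 - e = (1 - a) * c

theorem IsExchangeRing.of_ringEquiv {A B : Type*} [CommRing A] [CommRing B]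
    (h : IsExchangeRing B) (ψ : A ≃+* B) : IsExchangeRing A := fun a => by
  obtain ⟨e, b, c, h1, h2, h3⟩ := h (ψ a)
  refine ⟨ψ.symm e, ψ.symm b, ψ.symm c, ?_, ?_, ?_⟩
  · rw [← map_mul, h1]
  · rw [h2, map_mul, ψ.symm_apply_apply]
  · have := congrArg ψ.symm h3
    simpa using this

theorem MaximalSpectrum.isOpen_iff {R : Type*} [CommRing R] {U : Set (MaximalSpectrum R)} :
    IsOpen U ↔ ∀ M ∈ U, ∃ a : R, a ∉ M.asIdeal ∧
      ∀ N : MaximalSpectrum R, a ∉ N.asIdeal → N ∈ U := by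
  have hb := PrimeSpectrum.isTopologicalBasis_basic_opens (R := R)
  have hb' := hb.induced (MaximalSpectrum.toPrimeSpectrum (R := R))
  rw [hb'.isOpen_iff]
  refine forall₂_congr fun M _ => ?_
  constructor
  · rintro ⟨_, ⟨_, ⟨a, rfl⟩, rfl⟩, h1, h2⟩
    exact ⟨a, h1, fun N hN => h2 hN⟩
  · rintro ⟨a, h1, h2⟩
    exact ⟨_, ⟨_, ⟨a, rfl⟩, rfl⟩, h1, fun N hN => h2 N hN⟩

/-- A map of a Boolean ring `E` onto the set of idempotents of a commutative ring `B` that is an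
isomorphism of Boolean algebras. -/
structure IsIdempotentIso {E B : Type*} [BooleanRing E] [CommRing B] (h : E → B) : Prop where
  map_mul : ∀ e f, h (e * f) = h e * h f
  map_compl : ∀ e, h (1 + e) = 1 - h e
  map_one : h 1 = 1
  eq_one : ∀ e, h e = 1 → e = 1
  surj : ∀ b : B, b * b = b → ∃ e, h e = b

namespace IsIdempotentIso

variable {E B : Type*} [BooleanRing E] [CommRing B] {h : E → B}

theorem map_zero (hh : IsIdempotentIso h) : h 0 = 0 := by
  have := hh.map_compl 1
  rwa [hh.map_one, sub_self, BooleanRing.add_self] at this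

/-- The trace on `E` of an ideal of `B`. -/
def trace (hh : IsIdempotentIso h) (M : Ideal B) : Ideal E where
  carrier := {e | h e ∈ M}
  zero_mem' := by simp [hh.map_zero]
  add_mem' {e f} he hf := by
    -- The map `h` is not additive, since the sum of `E` is not that of `B`. What survives is that
    -- `e + f` lies below the join of `e` and `f`, expressed with products and complements only.
    have h0 : (1 + e) * (1 + f) * (e + f) = 0 := by
      have he := BooleanRing.mul_self e
      have hf := BooleanRing.mul_self f
      have h2 := BooleanRing.add_self (e * f)
      have h3 := BooleanRing.add_self e
      have h4 := BooleanRing.add_self f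
      linear_combination (1 + f) * he + (1 + e) * hf + h3 + h4 + 2 * h2
    have h1 : (1 - h e) * (1 - h f) * h (e + f) = 0 := by
      rw [← hh.map_compl, ← hh.map_compl, ← hh.map_mul, ← hh.map_mul, h0, hh.map_zero]
    have h2 : h (e + f) = h (e + f) * (1 - h f) * h e + h (e + f) * h f := by
      linear_combination h1
    show h (e + f) ∈ M
    rw [h2]
    exact M.add_mem (M.mul_mem_left _ he) (M.mul_mem_left _ hf)
  smul_mem' c e he := by
    show h (c * e) ∈ M
    rw [hh.map_mul]
    exact M.mul_mem_left _ he

theorem mem_trace (hh : IsIdempotentIso h) {M : Ideal B} {e : E} :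
    e ∈ hh.trace M ↔ h e ∈ M := Iff.rfl

/-- Since `h e * h (1 + e) = 0` and `M` is prime, an idempotent outside the trace has its complement
inside, and the two add up to `1`. -/
theorem trace_isMaximal (hh : IsIdempotentIso h) (M : Ideal B) [M.IsMaximal] :
    (hh.trace M).IsMaximal := by
  rw [Ideal.isMaximal_iff]
  refine ⟨?_, fun J e hJ he heJ => ?_⟩
  · rw [mem_trace, hh.map_one]
    exact (Ideal.ne_top_iff_one M).1 (Ideal.IsMaximal.ne_top inferInstance)
  · rw [mem_trace] at he
    have h0 : h e * h (1 + e) = 0 := by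
      rw [← hh.map_mul, mul_add, mul_one, BooleanRing.mul_self, BooleanRing.add_self, hh.map_zero]
    have h1 : h (1 + e) ∈ M :=
      ((Ideal.IsMaximal.isPrime ‹_›).mem_or_mem (h0 ▸ M.zero_mem)).resolve_left he
    have h2 : 1 = (1 + e) + e := by rw [add_assoc, BooleanRing.add_self, add_zero]
    rw [h2]
    exact J.add_mem (hJ h1) heJ

/-- The ideal of `B` generated by the image of `P` is proper because each of its elements is killed
by `h (1 + p)` for some `p ∈ P`. A maximal ideal above it has trace containing `P`, hence equal to
`P`. No exchange property is needed here. -/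
theorem exists_trace_eq (hh : IsIdempotentIso h) (P : Ideal E) [hP : P.IsMaximal] :
    ∃ M : Ideal B, M.IsMaximal ∧ hh.trace M = P := by
  have key : ∀ x ∈ Ideal.span (h '' P), ∃ p ∈ P, h (1 + p) * x = 0 := by
    intro x hx
    induction hx using Submodule.span_induction with
    | mem x hx =>
      obtain ⟨p, hp, rfl⟩ := hx
      refine ⟨p, hp, ?_⟩
      rw [← hh.map_mul, add_mul, one_mul, BooleanRing.mul_self, BooleanRing.add_self,
        hh.map_zero]
    | zero => exact ⟨0, P.zero_mem, mul_zero _⟩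
    | add x y _ _ hx hy =>
      obtain ⟨p, hp, h1⟩ := hx
      obtain ⟨q, hq, h2⟩ := hy
      refine ⟨p + q + p * q, P.add_mem (P.add_mem hp hq) (P.mul_mem_left _ hq), ?_⟩
      have h3 : 1 + (p + q + p * q) = (1 + p) * (1 + q) := by ring
      rw [h3, hh.map_mul]
      linear_combination h (1 + q) * h1 + h (1 + p) * h2
    | smul a x _ hx =>
      obtain ⟨p, hp, h1⟩ := hx
      refine ⟨p, hp, ?_⟩
      rw [smul_eq_mul]
      linear_combination a * h1
  have hne : Ideal.span (h '' P) ≠ ⊤ := by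
    rw [Ideal.ne_top_iff_one]
    intro h1
    obtain ⟨p, hp, h2⟩ := key 1 h1
    rw [mul_one, hh.map_compl, sub_eq_zero] at h2
    have := hh.eq_one p h2.symm
    exact (Ideal.ne_top_iff_one P).1 hP.ne_top (this ▸ hp)
  obtain ⟨M, hM, hle⟩ := Ideal.exists_le_maximal _ hne
  have := hh.trace_isMaximal M
  refine ⟨M, hM, (hP.eq_of_le this.ne_top fun p hp => ?_).symm⟩
  exact hle (Ideal.subset_span ⟨p, hp, rfl⟩)

/-- For `a ∈ M` and `b ∈ N` with `a + b = 1`, the exchange idempotent of `a` lies in `M` while its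
complement is a multiple of `b`, so lies in `N`. Equal traces would put both in `N`. -/
theorem trace_injective (hh : IsIdempotentIso h) (hB : IsExchangeRing B) {M N : Ideal B}
    [hM : M.IsMaximal] [hN : N.IsMaximal] (heq : hh.trace M = hh.trace N) : M = N := by
  by_contra hne
  have h1 := Ideal.isCoprime_iff_exists.1 (Ideal.isCoprime_of_isMaximal hne)
  obtain ⟨a, ha, b, hb, hab⟩ := h1
  obtain ⟨e, x, y, he, hx, hy⟩ := hB a
  obtain ⟨e, rfl⟩ := hh.surj e he
  have h2 : h e ∈ M := hx ▸ M.mul_mem_right _ ha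
  have h3 : h e ∈ N := by
    rw [← hh.mem_trace, ← heq]
    exact h2
  refine (Ideal.ne_top_iff_one N).1 hN.ne_top ?_
  have h4 : 1 = h e + b * y := by
    linear_combination hy - y * hab
  rw [h4]
  exact N.add_mem h3 (N.mul_mem_right _ hb)

/-- The maximal ideals of an exchange ring correspond to those of its Boolean ring of
idempotents. -/
def maximalSpectrumHomeomorph (hh : IsIdempotentIso h) (hB : IsExchangeRing B) :
    MaximalSpectrum B ≃ₜ MaximalSpectrum E :=
  let F : MaximalSpectrum B → MaximalSpectrum E := fun M =>
    ⟨hh.trace M.asIdeal, have := M.isMaximal; hh.trace_isMaximal M.asIdeal⟩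
  have hF : Function.Bijective F := by
    constructor
    · intro M N hMN
      have := M.isMaximal
      have := N.isMaximal
      exact MaximalSpectrum.ext (hh.trace_injective hB (congrArg MaximalSpectrum.asIdeal hMN))
    · intro P
      have := P.isMaximal
      obtain ⟨M, hM, h1⟩ := hh.exists_trace_eq P.asIdeal
      exact ⟨⟨M, hM⟩, MaximalSpectrum.ext h1⟩
  (Equiv.ofBijective F hF).toHomeomorphOfContinuousOpen
    ⟨fun U hU => by
      rw [MaximalSpectrum.isOpen_iff] at hU ⊢
      intro M hM
      obtain ⟨e, h1, h2⟩ := hU (F M) hM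
      exact ⟨h e, h1, fun N hN => h2 (F N) hN⟩⟩
    (fun U hU => by
      rw [MaximalSpectrum.isOpen_iff] at hU ⊢
      rintro _ ⟨M, hM, rfl⟩
      obtain ⟨a, h1, h2⟩ := hU M hM
      have hmax := M.isMaximal
      -- With `b` inverse to `a` modulo `M`, the exchange idempotent of `b * a` is a multiple of `a`
      -- and is `1` modulo `M`. Its basic open set therefore contains `M` and lies inside that of
      -- `a`.
      obtain ⟨b, m, hm, hbm⟩ := hmax.exists_inv h1
      obtain ⟨e, x, y, he, hx, hy⟩ := hB (b * a)
      obtain ⟨e, rfl⟩ := hh.surj e he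
      refine ⟨e, fun h3 => ?_, fun N hN => ?_⟩
      · refine (Ideal.ne_top_iff_one _).1 hmax.ne_top ?_
        have h4 : 1 = h e + m * y := by linear_combination hy - y * hbm
        rw [h4]
        exact Ideal.add_mem _ h3 (Ideal.mul_mem_right _ _ hm)
      · obtain ⟨N, rfl⟩ := hF.2 N
        refine ⟨N, h2 N fun h3 => hN ?_, rfl⟩
        show h e ∈ N.asIdeal
        rw [hx]
        exact Ideal.mul_mem_right _ _ (Ideal.mul_mem_left _ _ h3))

end IsIdempotentIso

/-! ### Transfer of idempotents along embeddings and to subrings -/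

section IdempotentRing

variable {A : Type u} {R : Type*} [CommRing A] [CommRing R]

/-- A ring embedding whose range has all idempotents identifies the idempotents of both rings. -/
theorem isIdempotentIso_comp (γ : A →+* R) (hγ : Function.Injective γ)
    (hsurj : ∀ r : R, r * r = r → r ∈ γ.range) :
    IsIdempotentIso fun e : IdempotentRing A => γ (ofBoolRing e).1 where
  map_mul e f := by rw [IdempotentRing.coe_mul, map_mul]
  map_compl e := by
    rw [IdempotentRing.coe_add]
    have : (ofBoolRing (1 : IdempotentRing A)).1 = 1 := rfl
    rw [this, ← map_one γ, ← map_sub]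
    congr 1
    ring
  map_one := map_one γ
  eq_one e he := by
    have : (ofBoolRing e).1 = 1 := hγ (he.trans (map_one γ).symm)
    exact ofBoolRing.injective (Subtype.ext this)
  surj r hr := by
    obtain ⟨a, rfl⟩ := hsurj r hr
    exact ⟨toBoolRing ⟨a, hγ (by rw [map_mul, hr])⟩, rfl⟩

/-- The same for a subring that has all the idempotents. -/
theorem IsIdempotentIso.codRestrict {E : Type*} [BooleanRing E] {h : E → R}
    (hh : IsIdempotentIso h) (S : Subring R) (hS : ∀ r : R, r * r = r → r ∈ S) :
    IsIdempotentIso fun e : E =>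
      (⟨h e, hS _ (by rw [← hh.map_mul, BooleanRing.mul_self])⟩ : S) where
  map_mul e f := Subtype.ext (hh.map_mul e f)
  map_compl e := Subtype.ext (hh.map_compl e)
  map_one := Subtype.ext hh.map_one
  eq_one e he := hh.eq_one e (congrArg Subtype.val he)
  surj b hb := by
    obtain ⟨e, he⟩ := hh.surj b (congrArg Subtype.val hb)
    exact ⟨e, Subtype.ext he⟩

end IdempotentRing

/-! ### Recognition of the maximal ring of quotients -/

namespace MaxQuot

variable {A : Type u} [CommRing A] {B : Type*} [CommRing B] [Algebra A B]

/-- An `A`-algebra on which dense ideals act faithfully, in which each homomorphism on a dense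
ideal is multiplication by an element, and all of whose elements are fractions over dense ideals
is the maximal ring of quotients of `A`. -/
theorem nonempty_algEquiv (hinj : Function.Injective (algebraMap A B))
    (hfaith : ∀ D : Ideal A, IsDenseIdeal D → ∀ b : B,
      (∀ d ∈ D, algebraMap A B d * b = 0) → b = 0)
    (hrep : ∀ φ : DenseHom A, ∃ b : B, ∀ (d : A) (hd : d ∈ φ.dom),
      algebraMap A B d * b = algebraMap A B (φ.hom ⟨d, hd⟩))
    (hfrac : ∀ b : B, ∃ D : Ideal A, IsDenseIdeal D ∧ ∀ d ∈ D,
      ∃ a : A, algebraMap A B d * b = algebraMap A B a) :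
    Nonempty (MaxQuot A ≃ₐ[A] B) := by
  have huniq : ∀ (D : Ideal A), IsDenseIdeal D → ∀ b c : B,
      (∀ d ∈ D, algebraMap A B d * b = algebraMap A B d * c) → b = c := fun D hD b c h =>
    sub_eq_zero.1 (hfaith D hD _ fun d hd => by rw [mul_sub, h d hd, sub_self])
  choose F hF using hrep
  -- By faithfulness, `F φ` is recognised from its products with any dense ideal inside the domain;
  -- most of the verifications below reduce to this.
  have hval : ∀ (φ : DenseHom A) (D : Ideal A) (b : B), IsDenseIdeal D →
      (∀ d ∈ D, ∃ hd : d ∈ φ.dom, algebraMap A B d * b = algebraMap A B (φ.hom ⟨d, hd⟩)) →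
      F φ = b := fun φ D b hD h => huniq D hD _ _ fun d hd => by
    obtain ⟨h1, h2⟩ := h d hd
    rw [hF φ d h1, h2]
  have hwd : ∀ φ ψ : DenseHom A, DenseHom.Rel φ ψ → F φ = F ψ := fun φ ψ h =>
    hval φ (φ.dom ⊓ ψ.dom) _ (φ.dense.inf ψ.dense) fun d hd =>
      ⟨hd.1, by rw [hF ψ d hd.2, h d hd.1 hd.2]⟩
  let G : MaxQuot A → B := Quotient.lift F hwd
  have hG : ∀ φ, G (mk φ) = F φ := fun _ => rfl
  have hofElem : ∀ a, F (DenseHom.ofElem a) = algebraMap A B a := fun a =>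
    hval _ ⊤ _ isDenseIdeal_top fun d _ => ⟨mem_ofElem a d, by
      rw [ofElem_hom, map_mul, mul_comm]⟩
  let Ghom : MaxQuot A →ₐ[A] B :=
    { toFun := G
      map_one' := (hofElem 1).trans (map_one _)
      map_zero' := (hofElem 0).trans (map_zero _)
      map_add' := fun a b => by
        induction a using ind with | _ φ
        induction b using ind with | _ ψ
        exact hval _ (φ.dom ⊓ ψ.dom) _ (φ.dense.inf ψ.dense) fun d hd => ⟨hd, by
          rw [DenseHom.add_hom φ ψ hd.1 hd.2, map_add, hG, hG, mul_add, hF φ d hd.1, hF ψ d hd.2]⟩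
      map_mul' := fun a b => by
        induction a using ind with | _ φ
        induction b using ind with | _ ψ
        refine sub_eq_zero.1 (hfaith _ φ.dense _ fun d hd => hfaith _ ψ.dense _ fun e he => ?_)
        obtain ⟨h1, h2⟩ := DenseHom.mul_hom φ ψ hd he rfl
        have h3 := hF (DenseHom.mul φ ψ) (d * e) h1
        rw [h2, map_mul, map_mul, ← hF φ d hd, ← hF ψ e he] at h3
        rw [mk_mul, hG, hG, hG]
        linear_combination h3
      commutes' := hofElem }
  refine ⟨AlgEquiv.ofBijective Ghom ⟨?_, fun b => ?_⟩⟩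
  · rw [injective_iff_map_eq_zero]
    intro a ha
    induction a using ind with | _ φ
    refine mk_eq_of_set (ψ := DenseHom.ofElem 0) φ.dom φ.dense fun d hd =>
      ⟨hd, mem_ofElem 0 d, hinj ?_⟩
    have h1 : F φ = 0 := ha
    rw [← hF φ d hd, h1, mul_zero, ofElem_hom, zero_mul, map_zero]
  · obtain ⟨D, hD, h⟩ := hfrac b
    choose f hf using h
    let φ : DenseHom A :=
      { dom := D
        dense := hD
        hom :=
          { toFun := fun d => f d.1 d.2
            map_add' := fun d e => hinj (by
              rw [map_add, ← hf, ← hf, ← hf, Submodule.coe_add, map_add, add_mul])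
            map_smul' := fun c d => hinj (by
              rw [RingHom.id_apply, smul_eq_mul, map_mul, ← hf, ← hf, Submodule.coe_smul,
                smul_eq_mul, map_mul, mul_assoc]) } }
    exact ⟨mk φ, hval φ D b hD fun d hd => ⟨hd, hf d hd⟩⟩

end MaxQuot

/-! ### Elements of `C[𝒮]` as functions on the whole space -/

namespace DenseFilterBase

section

variable {X : Type u} [TopologicalSpace X] {𝒮 : DenseFilterBase X}

/-- Continuous functions that agree on a dense subset of `X` agree on all of their common domain. -/
theorem eqOn_of_dense {D S : Set X} {f g : X → ℝ} (hD : Dense D) (hDS : D ⊆ S)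
    (hf : ContinuousOn f S) (hg : ContinuousOn g S) (h : EqOn f g D) : EqOn f g S :=
  h.of_subset_closure hf hg hDS fun x _ => hD x

/-- The element of `C[𝒮]` represented by a function on `X` that is continuous on `S ∈ 𝒮`. -/
def mkOn (S : Set X) (hS : S ∈ 𝒮.sets) (f : X → ℝ) (hf : ContinuousOn f S) : 𝒮.FunRing :=
  of (OrderDual.toDual ⟨S, hS⟩) ⟨S.domRestrict f, hf.domRestrict⟩

/-- Extending by zero gives representatives defined on all of `X`, so that shrinking a domain leaves
the function unchanged. -/
theorem of_eq_mkOn (i : 𝒮.Index) (f : C(𝒮.carrier i, ℝ)) :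
    ∃ (F : X → ℝ) (hF : ContinuousOn F (𝒮.carrier i)),
      (∀ x : 𝒮.carrier i, F x = f x) ∧ of i f = mkOn (𝒮.carrier i) (OrderDual.ofDual i).2 F hF := by
  classical
  let F : X → ℝ := fun x => if h : x ∈ 𝒮.carrier i then f ⟨x, h⟩ else 0
  have hF : (𝒮.carrier i).domRestrict F = f := by
    ext ⟨x, hx⟩
    simp only [Set.domRestrict_apply, F]
    exact dif_pos hx
  have hF' : ContinuousOn F (𝒮.carrier i) := by
    rw [continuousOn_iff_continuous_domRestrict, hF]
    exact f.continuous
  refine ⟨F, hF', congrFun hF, congrArg (of i) ?_⟩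
  ext x
  exact (congrFun hF x).symm

theorem exists_eq_mkOn (a : 𝒮.FunRing) : ∃ S hS f hf, a = mkOn S hS f hf := by
  induction a using ind with | _ i f
  obtain ⟨F, hF, -, h⟩ := of_eq_mkOn i f
  exact ⟨_, _, F, hF, h⟩

theorem mkOn_mono {S T : Set X} {hS : S ∈ 𝒮.sets} (hT : T ∈ 𝒮.sets) (hTS : T ⊆ S) {f : X → ℝ}
    (hf : ContinuousOn f S) : mkOn S hS f hf = mkOn T hT f (hf.mono hTS) :=
  (of_restrict (OrderDual.toDual ⟨S, hS⟩) (OrderDual.toDual ⟨T, hT⟩) hTS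
    ⟨S.domRestrict f, hf.domRestrict⟩).symm

theorem mkOn_congr {S : Set X} {hS : S ∈ 𝒮.sets} {f g : X → ℝ} {hf : ContinuousOn f S}
    {hg : ContinuousOn g S} (h : EqOn f g S) : mkOn S hS f hf = mkOn S hS g hg :=
  congrArg (of _) (by ext x; exact h x.2)

/-- The set `D` need not belong to `𝒮`: continuity spreads equality from `D` to `S ∩ T`, which does.
-/
theorem mkOn_eq_of_dense {S T : Set X} {hS : S ∈ 𝒮.sets} {hT : T ∈ 𝒮.sets} {f g : X → ℝ}
    {hf : ContinuousOn f S} {hg : ContinuousOn g T} {D : Set X} (hD : Dense D) (hDS : D ⊆ S)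
    (hDT : D ⊆ T) (h : EqOn f g D) : mkOn S hS f hf = mkOn T hT g hg := by
  rw [mkOn_mono (𝒮.inter S hS T hT) inter_subset_left,
    mkOn_mono (𝒮.inter S hS T hT) inter_subset_right]
  exact mkOn_congr (eqOn_of_dense hD (subset_inter hDS hDT) (hf.mono inter_subset_left)
    (hg.mono inter_subset_right) h)

theorem mkOn_add {S : Set X} {hS : S ∈ 𝒮.sets} {f g : X → ℝ} (hf : ContinuousOn f S)
    (hg : ContinuousOn g S) : mkOn S hS f hf + mkOn S hS g hg =
      mkOn S hS (fun x => f x + g x) (hf.add hg) := of_add _ _ _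

theorem mkOn_sub {S : Set X} {hS : S ∈ 𝒮.sets} {f g : X → ℝ} (hf : ContinuousOn f S)
    (hg : ContinuousOn g S) : mkOn S hS f hf - mkOn S hS g hg =
      mkOn S hS (fun x => f x - g x) (hf.sub hg) := of_sub _ _ _

theorem mkOn_mul {S : Set X} {hS : S ∈ 𝒮.sets} {f g : X → ℝ} (hf : ContinuousOn f S)
    (hg : ContinuousOn g S) : mkOn S hS f hf * mkOn S hS g hg =
      mkOn S hS (fun x => f x * g x) (hf.mul hg) := of_mul _ _ _

theorem mkOn_one {S : Set X} (hS : S ∈ 𝒮.sets) :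
    mkOn S hS (fun _ => 1) continuousOn_const = 1 := of_one _

theorem mkOn_zero {S : Set X} (hS : S ∈ 𝒮.sets) :
    mkOn S hS (fun _ => 0) continuousOn_const = 0 := of_zero _

theorem algebraMap_eq_mkOn {S : Set X} (hS : S ∈ 𝒮.sets) (f : C(X, ℝ)) :
    algebraMap C(X, ℝ) 𝒮.FunRing f = mkOn S hS f f.continuous.continuousOn :=
  ofContinuous_eq _ f

/-- For a dense set `D ⊆ S`, the distance is determined by the values on `D`. -/
theorem dist_mkOn_le_iff {S D : Set X} {hS : S ∈ 𝒮.sets} {f g : X → ℝ} {hf : ContinuousOn f S}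
    {hg : ContinuousOn g S} (hD : Dense D) (hDS : D ⊆ S) {ε : ℝ} (hε : 0 ≤ ε) :
    dist (mkOn S hS f hf) (mkOn S hS g hg) ≤ ε ↔
      ∀ x ∈ D, |f x - g x| / (1 + |f x - g x|) ≤ ε := by
  have h0 : dist (mkOn S hS f hf) (mkOn S hS g hg) =
      ⨆ x : S, |f x - g x| / (1 + |f x - g x|) := dist_of _ _ _
  rw [h0]
  constructor
  · intro h x hx
    refine le_trans ?_ h
    exact le_ciSup (f := fun x : S => |f x - g x| / (1 + |f x - g x|))
      ⟨1, by rintro _ ⟨x, rfl⟩; exact (frac_lt_one _).le⟩ ⟨x, hDS hx⟩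
  · intro h
    refine Real.iSup_le (fun x => ?_) hε
    have hfc : Continuous fun x : S => f x := hf.domRestrict
    have hgc : Continuous fun x : S => g x := hg.domRestrict
    have hc : IsClosed {x : S | |f x - g x| / (1 + |f x - g x|) ≤ ε} := by
      have hfg := (hfc.sub hgc).abs
      refine isClosed_le (hfg.div (continuous_const.add hfg) fun x => ?_) continuous_const
      positivity
    have hd : Dense (Subtype.val ⁻¹' D : Set S) := by
      refine IsInducing.subtypeVal.dense_iff.2 fun x => ?_
      rw [Subtype.image_preimage_coe, inter_eq_right.2 hDS]
      exact hD _
    exact hc.closure_subset_iff.2 (fun y hy => h _ hy) (hd x)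

theorem mkOn_mem_bounded {S : Set X} {hS : S ∈ 𝒮.sets} {f : X → ℝ} {hf : ContinuousOn f S}
    {r : ℝ} (h : ∀ x ∈ S, |f x| ≤ r) : mkOn S hS f hf ∈ 𝒮.bounded :=
  ⟨_, _, r, rfl, fun x => h x x.2⟩

/-! ### Idempotents -/

theorem mkOn_injective {S : Set X} {hS : S ∈ 𝒮.sets} {f g : X → ℝ}
    {hf : ContinuousOn f S} {hg : ContinuousOn g S} (h : mkOn S hS f hf = mkOn S hS g hg) :
    EqOn f g S := by
  intro x hx
  have h1 := (dist_mkOn_le_iff (𝒮.dense S hS) subset_rfl le_rfl).1 (dist_eq_zero.2 h).le x hx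
  have h2 : |f x - g x| / (1 + |f x - g x|) = 0 := le_antisymm h1 (frac_nonneg _)
  have h3 : 1 + |f x - g x| ≠ 0 := by positivity
  have h4 : f x - g x = 0 := by simpa [h3] using h2
  exact sub_eq_zero.1 h4

theorem eq_zero_or_one_of_idempotent {S : Set X} {hS : S ∈ 𝒮.sets} {f : X → ℝ}
    {hf : ContinuousOn f S} (h : mkOn S hS f hf * mkOn S hS f hf = mkOn S hS f hf)
    {x : X} (hx : x ∈ S) : f x = 0 ∨ f x = 1 := by
  rw [mkOn_mul] at h
  have h1 : f x * f x = f x := mkOn_injective h hx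
  have h2 : f x * (f x - 1) = 0 := by linear_combination h1
  rcases mul_eq_zero.1 h2 with h | h
  · exact Or.inl h
  · exact Or.inr (sub_eq_zero.1 h)

theorem mem_bounded_of_idempotent {a : 𝒮.FunRing} (h : a * a = a) : a ∈ 𝒮.bounded := by
  obtain ⟨S, hS, f, hf, rfl⟩ := exists_eq_mkOn a
  refine mkOn_mem_bounded (r := 1) fun x hx => ?_
  rcases eq_zero_or_one_of_idempotent h hx with h | h <;> simp [h]

open Classical in
theorem continuousOn_ite_of_isOpen {S U V : Set X} {f g : X → ℝ} (hU : IsOpen U) (hV : IsOpen V)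
    (hUV : Disjoint U V) (hf : ContinuousOn f (S ∩ U)) (hg : ContinuousOn g (S ∩ V)) :
    ContinuousOn (fun x => if x ∈ U then f x else g x) (S ∩ (U ∪ V)) := by
  rintro x ⟨hxS, hx | hx⟩
  · have h1 : ContinuousWithinAt (fun x => if x ∈ U then f x else g x) (S ∩ U) x :=
      (hf x ⟨hxS, hx⟩).congr (fun y hy => if_pos hy.2) (if_pos hx)
    have h2 := (continuousWithinAt_inter (hU.mem_nhds hx)).1 h1
    exact h2.mono inter_subset_left
  · have h0 : ∀ y ∈ V, y ∉ U := fun y hy hy' => disjoint_left.1 hUV hy' hy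
    have h1 : ContinuousWithinAt (fun x => if x ∈ U then f x else g x) (S ∩ V) x :=
      (hg x ⟨hxS, hx⟩).congr (fun y hy => if_neg (h0 y hy.2)) (if_neg (h0 x hx))
    have h2 := (continuousWithinAt_inter (hV.mem_nhds hx)).1 h1
    exact h2.mono inter_subset_left

theorem dense_union_compl_closure {U : Set X} : Dense (U ∪ (closure U)ᶜ) := fun x => by
  rw [closure_union]
  by_cases h : x ∈ closure U
  · exact Or.inl h
  · exact Or.inr (subset_closure h)

-- Here `e` is the indicator of the open set `f > 1/3`, while `b` is `1/f` there and `c` is `1/(1 -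
-- f)` elsewhere, each extended by zero. Any threshold strictly between `0` and `1` would do; this
-- one bounds both inverses by `3`.
open Classical in
theorem exists_idempotent_factors (h𝒮 : ∀ U, IsOpen U → Dense U → U ∈ 𝒮.sets) (a : 𝒮.FunRing) :
    ∃ e, ∃ b ∈ 𝒮.bounded, ∃ c ∈ 𝒮.bounded, e * e = e ∧ e = a * b ∧ 1 - e = (1 - a) * c := by
  obtain ⟨S, hS, f, hf, rfl⟩ := exists_eq_mkOn a
  -- As `S` need not be open, `U` is an open set of `X` whose trace on `S` is the set `f > 1/3`.
  obtain ⟨U, hU, hUS⟩ := (continuousOn_iff'.1 hf) (Ioi (1 / 3)) isOpen_Ioi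
  have hUf : ∀ x ∈ S, x ∈ U → 1 / 3 < f x := fun x hx hxU => (hUS.superset ⟨hxU, hx⟩).1
  have hUf' : ∀ x ∈ S, x ∉ U → f x ≤ 1 / 3 := fun x hx hxU =>
    not_lt.1 fun h => hxU (hUS.subset ⟨h, hx⟩).1
  have hV : IsOpen (closure U)ᶜ := isClosed_closure.isOpen_compl
  have hUV : Disjoint U (closure U)ᶜ :=
    disjoint_compl_right.mono_left subset_closure
  have hVU : ∀ x ∈ (closure U)ᶜ, x ∉ U := fun x hx hx' => hx (subset_closure hx')
  let W : Set X := U ∪ (closure U)ᶜ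
  have hT : S ∩ W ∈ 𝒮.sets := 𝒮.inter S hS W (h𝒮 W (hU.union hV) dense_union_compl_closure)
  have he : ContinuousOn (fun x => if x ∈ U then (1 : ℝ) else 0) (S ∩ W) :=
    continuousOn_ite_of_isOpen hU hV hUV continuousOn_const continuousOn_const
  have hb : ContinuousOn (fun x => if x ∈ U then (f x)⁻¹ else 0) (S ∩ W) :=
    continuousOn_ite_of_isOpen hU hV hUV
      ((hf.mono inter_subset_left).inv₀ fun x hx => by linarith [hUf x hx.1 hx.2])
      continuousOn_const
  have hc : ContinuousOn (fun x => if x ∈ U then 0 else (1 - f x)⁻¹) (S ∩ W) :=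
    continuousOn_ite_of_isOpen hU hV hUV continuousOn_const
      ((continuousOn_const.sub (hf.mono inter_subset_left)).inv₀ fun x hx =>
        sub_ne_zero.2 (by linarith [hUf' x hx.1 (hVU x hx.2)] : f x < 1).ne')
  refine ⟨mkOn _ hT _ he, mkOn _ hT _ hb, mkOn_mem_bounded (r := 3) fun x hx => ?_,
    mkOn _ hT _ hc, mkOn_mem_bounded (r := 3) fun x hx => ?_, ?_, ?_, ?_⟩
  · by_cases h : x ∈ U
    · have := hUf x hx.1 h
      simp only [h, if_true]
      rw [abs_inv, abs_of_pos (by linarith)]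
      exact inv_le_of_inv_le₀ (by norm_num) (by linarith)
    · simp [h]
  · by_cases h : x ∈ U
    · simp [h]
    · have := hUf' x hx.1 h
      simp only [h, if_false]
      rw [abs_inv, abs_of_pos (by linarith)]
      exact inv_le_of_inv_le₀ (by norm_num) (by linarith)
  · rw [mkOn_mul]
    refine mkOn_congr fun x _ => ?_
    by_cases h : x ∈ U <;> simp [h]
  · rw [mkOn_mono hT inter_subset_left hf, mkOn_mul]
    refine mkOn_congr fun x hx => ?_
    by_cases h : x ∈ U
    · have := hUf x hx.1 h
      simp only [h, if_true]
      rw [mul_inv_cancel₀ (by linarith)]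
    · simp [h]
  · rw [mkOn_mono hT inter_subset_left hf, ← mkOn_one hT, mkOn_sub, mkOn_sub, mkOn_mul]
    refine mkOn_congr fun x hx => ?_
    by_cases h : x ∈ U
    · simp [h]
    · have := hUf' x hx.1 h
      simp only [h, if_false]
      rw [mul_inv_cancel₀ (by linarith), sub_zero]

theorem isExchangeRing (h𝒮 : ∀ U, IsOpen U → Dense U → U ∈ 𝒮.sets) : IsExchangeRing 𝒮.FunRing :=
  fun a => by
    obtain ⟨e, b, -, c, -, h⟩ := exists_idempotent_factors h𝒮 a
    exact ⟨e, b, c, h⟩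

theorem isExchangeRing_bounded (h𝒮 : ∀ U, IsOpen U → Dense U → U ∈ 𝒮.sets) :
    IsExchangeRing 𝒮.bounded := fun a => by
  obtain ⟨e, b, hb, c, hc, h1, h2, h3⟩ := exists_idempotent_factors h𝒮 a.1
  exact ⟨⟨e, mem_bounded_of_idempotent h1⟩, ⟨b, hb⟩, ⟨c, hc⟩, Subtype.ext h1, Subtype.ext h2,
    Subtype.ext h3⟩

end

end DenseFilterBase

/-! ### `C(V)`, `V` dense open, as the maximal ring of quotients -/

section Representation

open DenseFilterBase

variable {X : Type u} [TopologicalSpace X]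

theorem exists_continuousMap_eq_one [CompletelyRegularSpace X] {K : Set X} (hK : IsClosed K)
    {x : X} (hx : x ∉ K) : ∃ d : C(X, ℝ), d x = 1 ∧ ∀ y ∈ K, d y = 0 := by
  obtain ⟨g, hg, h1, h2⟩ := CompletelyRegularSpace.completely_regular x K hK hx
  refine ⟨⟨fun y => 1 - (g y : ℝ), by fun_prop⟩, ?_, fun y hy => ?_⟩
  · simp [h1]
  · simp [h2 hy]

/-- The points at which some function in the ideal does not vanish. -/
def cozeroSet (D : Ideal C(X, ℝ)) : Set X := {x | ∃ d ∈ D, d x ≠ 0}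

theorem isOpen_cozeroSet (D : Ideal C(X, ℝ)) : IsOpen (cozeroSet D) := by
  have : cozeroSet D = ⋃ d ∈ D, {x | d x ≠ 0} := by
    ext x
    simp [cozeroSet]
  rw [this]
  exact isOpen_biUnion fun d _ => isOpen_ne_fun d.continuous continuous_const

/-- A function vanishing on the closure of the cozero set annihilates `D`; complete regularity
supplies a nonzero one if that closure is not everything. -/
theorem IsDenseIdeal.dense_cozeroSet [CompletelyRegularSpace X] {D : Ideal C(X, ℝ)}
    (hD : IsDenseIdeal D) : Dense (cozeroSet D) := fun x => by
  by_contra hx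
  obtain ⟨a, h1, h2⟩ := exists_continuousMap_eq_one isClosed_closure hx
  have ha : a = 0 := hD a fun d hd => by
    ext y
    by_cases hy : d y = 0
    · simp [hy]
    · simp [h2 y (subset_closure ⟨d, hd, hy⟩)]
  simp [ha] at h1

theorem algebraMap_mul_mkOn {𝒮 : DenseFilterBase X} {S : Set X} (hS : S ∈ 𝒮.sets) {f : X → ℝ}
    (hf : ContinuousOn f S) (d : C(X, ℝ)) :
    algebraMap C(X, ℝ) 𝒮.FunRing d * mkOn S hS f hf =
      mkOn S hS (fun x => d x * f x) (d.continuous.continuousOn.mul hf) := by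
  rw [algebraMap_eq_mkOn hS, mkOn_mul]

theorem algebraMap_funRing_injective (𝒮 : DenseFilterBase X) :
    Function.Injective (algebraMap C(X, ℝ) 𝒮.FunRing) := by
  intro f g h
  obtain ⟨S, hS⟩ := 𝒮.nonempty
  rw [algebraMap_eq_mkOn hS, algebraMap_eq_mkOn hS] at h
  ext x
  exact eqOn_of_dense (𝒮.dense S hS) (subset_univ S) f.continuous.continuousOn
    g.continuous.continuousOn (mkOn_injective h) (mem_univ x)

theorem eq_zero_of_denseIdeal_mul_eq_zero [CompletelyRegularSpace X] {D : Ideal C(X, ℝ)}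
    (hD : IsDenseIdeal D) (b : QFun X)
    (h : ∀ d ∈ D, algebraMap C(X, ℝ) (QFun X) d * b = 0) : b = 0 := by
  obtain ⟨V, hV, f, hf, rfl⟩ := exists_eq_mkOn b
  rw [← mkOn_zero hV]
  refine mkOn_eq_of_dense (D := V ∩ cozeroSet D)
    (hV.2.inter_of_isOpen_right hD.dense_cozeroSet (isOpen_cozeroSet D))
    inter_subset_left inter_subset_left ?_
  rintro x ⟨hx, d, hd, hdx⟩
  have h1 := h d hd
  rw [algebraMap_mul_mkOn, ← mkOn_zero hV] at h1
  exact (mul_eq_zero.1 (mkOn_injective h1 hx)).resolve_left hdx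

-- The quotient `φ(d) / d` does not depend on `d`, because `d * φ(d') = d' * φ(d)`. It defines a
-- function on the cozero set of the domain, which is dense and open.
open Classical in
theorem DenseHom.exists_mul_eq [CompletelyRegularSpace X] (φ : DenseHom C(X, ℝ)) :
    ∃ b : QFun X, ∀ (d : C(X, ℝ)) (hd : d ∈ φ.dom),
      algebraMap C(X, ℝ) (QFun X) d * b = algebraMap C(X, ℝ) (QFun X) (φ.hom ⟨d, hd⟩) := by
  let f : X → ℝ := fun x => if h : ∃ d ∈ φ.dom, d x ≠ 0 then
    φ.hom ⟨h.choose, h.choose_spec.1⟩ x / h.choose x else 0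
  have hmul : ∀ x ∈ cozeroSet φ.dom, ∀ (d : C(X, ℝ)) (hd : d ∈ φ.dom),
      d x * f x = φ.hom ⟨d, hd⟩ x := by
    intro x hx d hd
    have hx' : ∃ d ∈ φ.dom, d x ≠ 0 := hx
    have h1 : f x = φ.hom ⟨hx'.choose, hx'.choose_spec.1⟩ x / hx'.choose x := dif_pos hx'
    rw [h1, ← mul_div_assoc, div_eq_iff hx'.choose_spec.2, mul_comm (φ.hom _ x)]
    exact DFunLike.congr_fun (φ.hom_mul_comm hd hx'.choose_spec.1) x
  -- The chosen denominator varies with the point; continuity at `x` is tested with a single `d`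
  -- that is nonzero near `x`.
  have hf : ContinuousOn f (cozeroSet φ.dom) := by
    rintro x ⟨d, hd, hdx⟩
    have hU : IsOpen {y | d y ≠ 0} := isOpen_ne_fun d.continuous continuous_const
    have h1 : ContinuousAt (fun y => φ.hom ⟨d, hd⟩ y / d y) x :=
      (φ.hom ⟨d, hd⟩).continuous.continuousAt.div d.continuous.continuousAt hdx
    refine (h1.congr ?_).continuousWithinAt
    filter_upwards [hU.mem_nhds hdx] with y hy
    rw [div_eq_iff hy, mul_comm]
    exact (hmul y ⟨d, hd, hy⟩ d hd).symm
  have hmem : cozeroSet φ.dom ∈ (denseOpens X).sets :=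
    ⟨isOpen_cozeroSet _, φ.dense.dense_cozeroSet⟩
  refine ⟨mkOn (cozeroSet φ.dom) hmem f hf, fun d hd => ?_⟩
  rw [algebraMap_mul_mkOn, algebraMap_eq_mkOn hmem]
  exact mkOn_congr fun x hx => hmul x hx d hd

-- The ideal is that of all `d` with `d * b` in `C(X)`. It is dense because it contains, for each
-- point of the domain `V` of `b`, a function equal to `1` there and supported well inside `V`.
open Classical in
theorem QFun.exists_denseIdeal_mul_eq [T35Space X] (b : QFun X) :
    ∃ D : Ideal C(X, ℝ), IsDenseIdeal D ∧ ∀ d ∈ D,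
      ∃ a : C(X, ℝ), algebraMap C(X, ℝ) (QFun X) d * b = algebraMap C(X, ℝ) (QFun X) a := by
  refine ⟨{ carrier := {d | ∃ a : C(X, ℝ), algebraMap C(X, ℝ) (QFun X) d * b =
              algebraMap C(X, ℝ) (QFun X) a}
            zero_mem' := ⟨0, by rw [map_zero, zero_mul]⟩
            add_mem' := ?_
            smul_mem' := ?_ }, fun a ha => ?_, fun d hd => hd⟩
  · rintro d e ⟨a, ha⟩ ⟨c, hc⟩
    exact ⟨a + c, by rw [map_add, map_add, add_mul, ha, hc]⟩
  · rintro e d ⟨a, ha⟩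
    exact ⟨e * a, by rw [smul_eq_mul, map_mul, map_mul, mul_assoc, ha]⟩
  obtain ⟨V, hV, f, hf, rfl⟩ := exists_eq_mkOn b
  suffices h : ∀ x ∈ V, a x = 0 by
    ext x
    exact eqOn_of_dense hV.2 (subset_univ V) a.continuous.continuousOn continuousOn_const h
      (mem_univ x)
  intro x hx
  -- Vanishing off `V` would not suffice, as `f` may be unbounded near the boundary. Since `d`
  -- vanishes off a closed `K ⊆ V`, the product `d * f` is zero near each point outside `V`.
  obtain ⟨K, hKx, hK, hKV⟩ := exists_mem_nhds_isClosed_subset (hV.1.mem_nhds hx)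
  obtain ⟨d, hdx, hd⟩ := exists_continuousMap_eq_one (x := x) isOpen_interior.isClosed_compl
    (not_not.2 (mem_interior_iff_mem_nhds.2 hKx))
  have hdK : ∀ y ∉ K, d y = 0 := fun y hy => hd y fun h => hy (interior_subset h)
  have hc : Continuous fun y => if y ∈ V then d y * f y else 0 := by
    rw [continuous_iff_continuousAt]
    intro y
    by_cases hy : y ∈ V
    · have h1 : ContinuousAt (fun y => d y * f y) y :=
        d.continuous.continuousAt.mul (hf.continuousAt (hV.1.mem_nhds hy))
      refine h1.congr ?_
      filter_upwards [hV.1.mem_nhds hy] with z hz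
      exact (if_pos hz).symm
    · refine (continuousAt_const (y := (0 : ℝ))).congr ?_
      filter_upwards [hK.isOpen_compl.mem_nhds fun h => hy (hKV h)] with z hz
      rw [hdK z hz, zero_mul, ite_self]
  have h := ha d ⟨⟨_, hc⟩, by
    rw [algebraMap_mul_mkOn, algebraMap_eq_mkOn hV]
    exact mkOn_congr fun y hy => (if_pos hy).symm⟩
  simpa [hdx] using DFunLike.congr_fun h x

theorem nonempty_algEquiv_QFun (X : Type u) [TopologicalSpace X] [T35Space X] :
    Nonempty (Q X ≃ₐ[C(X, ℝ)] QFun X) :=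
  MaxQuot.nonempty_algEquiv (algebraMap_funRing_injective _)
    (fun _ hD b => eq_zero_of_denseIdeal_mul_eq_zero hD b) DenseHom.exists_mul_eq
    QFun.exists_denseIdeal_mul_eq

end Representation

/-! ### Extension of functions over the Stone–Čech compactification -/

/-- A continuous real function on a dense set extends to a `G_δ` set. -/
theorem exists_extension_isGδ {K : Type*} [TopologicalSpace K] {A : Set K} (hA : Dense A)
    {f : K → ℝ} (hf : ContinuousOn f A) :
    ∃ (G : Set K) (g : K → ℝ), IsGδ G ∧ A ⊆ G ∧ ContinuousOn g G ∧ EqOn g f A := by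
  -- `O n` collects the points near which `f` oscillates by less than `1 / (n + 1)` on `A`. On the
  -- intersection `f` satisfies the Cauchy condition, so limits exist by completeness of `ℝ`.
  let O : ℕ → Set K := fun n => ⋃₀ {U | IsOpen U ∧
    ∀ x ∈ U ∩ A, ∀ y ∈ U ∩ A, dist (f x) (f y) < 1 / ((n : ℝ) + 1)}
  have hO : ∀ n, IsOpen (O n) := fun n => isOpen_sUnion fun U hU => hU.1
  have hlim : ∀ p ∈ ⋂ n, O n, ∃ y, Filter.Tendsto f (𝓝[A] p) (𝓝 y) := by
    intro p hp
    have hne : (𝓝[A] p).NeBot := mem_closure_iff_nhdsWithin_neBot.1 (hA p)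
    refine CompleteSpace.complete (f := Filter.map f (𝓝[A] p))
      (Metric.cauchy_iff.2 ⟨hne.map f, fun ε hε => ?_⟩)
    obtain ⟨n, hn⟩ := exists_nat_one_div_lt hε
    obtain ⟨U, ⟨hU, hUA⟩, hpU⟩ := mem_iInter.1 hp n
    refine ⟨f '' (U ∩ A), Filter.image_mem_map 
      (Filter.inter_mem (mem_nhdsWithin_of_mem_nhds (hU.mem_nhds hpU)) self_mem_nhdsWithin), ?_⟩
    rintro _ ⟨x, hx, rfl⟩ _ ⟨y, hy, rfl⟩
    exact (hUA x hx y hy).trans hn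
  refine ⟨⋂ n, O n, extendFrom A f, IsGδ.iInter_of_isOpen hO, fun x hx => mem_iInter.2 fun n => ?_,
    continuousOn_extendFrom (fun x _ => hA x) hlim, fun x hx => extendFrom_eq (hA x) (hf x hx)⟩
  have hn : (0 : ℝ) < 1 / ((n : ℝ) + 1) / 2 := by positivity
  obtain ⟨U, hU, hUA⟩ := continuousOn_iff'.1 hf (Metric.ball (f x) (1 / ((n : ℝ) + 1) / 2))
    Metric.isOpen_ball
  have hball : ∀ y ∈ U ∩ A, dist (f y) (f x) < 1 / ((n : ℝ) + 1) / 2 := fun y hy =>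
    (hUA.superset hy).1
  refine ⟨U, ⟨hU, fun y hy z hz => ?_⟩, (hUA.subset ⟨Metric.mem_ball_self hn, hx⟩).1⟩
  have h1 := hball y hy
  have h2 := hball z hz
  have h3 := dist_triangle_right (f y) (f z) (f x)
  linarith

section Extension

open DenseFilterBase

variable {X : Type u} [TopologicalSpace X]

/-- The function `b` on a dense `G_δ` set of `βX` extends the function `a` on a dense open set
of `X`. -/
def Extends (a : QFun X) (b : QBar X) : Prop :=
  ∃ V hV f hf G hG g hg, a = mkOn V hV f hf ∧ b = mkOn G hG g hg ∧
    ∀ x ∈ V, stoneCechUnit x ∈ G ∧ g (stoneCechUnit x) = f x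

theorem Extends.exists_common {a a' : QFun X} {b b' : QBar X} (h : Extends a b)
    (h' : Extends a' b') : ∃ V hV f hf f' hf' G hG g hg g' hg',
      a = mkOn V hV f hf ∧ a' = mkOn V hV f' hf' ∧ b = mkOn G hG g hg ∧ b' = mkOn G hG g' hg' ∧
      ∀ x ∈ V, stoneCechUnit x ∈ G ∧ g (stoneCechUnit x) = f x ∧
        g' (stoneCechUnit x) = f' x := by
  obtain ⟨V, hV, f, hf, G, hG, g, hg, rfl, rfl, h⟩ := h
  obtain ⟨V', hV', f', hf', G', hG', g', hg', rfl, rfl, h'⟩ := h'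
  exact ⟨V ∩ V', DenseFilterBase.inter _ V hV V' hV', f, hf.mono inter_subset_left, f',
    hf'.mono inter_subset_right, G ∩ G', DenseFilterBase.inter _ G hG G' hG', g,
    hg.mono inter_subset_left, g', hg'.mono inter_subset_right, mkOn_mono _ inter_subset_left _,
    mkOn_mono _ inter_subset_right _, mkOn_mono _ inter_subset_left _,
    mkOn_mono _ inter_subset_right _, fun x hx =>
      ⟨⟨(h x hx.1).1, (h' x hx.2).1⟩, (h x hx.1).2, (h' x hx.2).2⟩⟩

theorem Extends.add {a a' : QFun X} {b b' : QBar X} (h : Extends a b) (h' : Extends a' b') :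
    Extends (a + a') (b + b') := by
  obtain ⟨V, hV, f, hf, f', hf', G, hG, g, hg, g', hg', rfl, rfl, rfl, rfl, h⟩ :=
    h.exists_common h'
  refine ⟨_, _, _, _, _, _, _, _, mkOn_add hf hf', mkOn_add hg hg', fun x hx => ?_⟩
  obtain ⟨h1, h2, h3⟩ := h x hx
  exact ⟨h1, by rw [h2, h3]⟩

theorem Extends.mul {a a' : QFun X} {b b' : QBar X} (h : Extends a b) (h' : Extends a' b') :
    Extends (a * a') (b * b') := by
  obtain ⟨V, hV, f, hf, f', hf', G, hG, g, hg, g', hg', rfl, rfl, rfl, rfl, h⟩ :=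
    h.exists_common h'
  refine ⟨_, _, _, _, _, _, _, _, mkOn_mul hf hf', mkOn_mul hg hg', fun x hx => ?_⟩
  obtain ⟨h1, h2, h3⟩ := h x hx
  exact ⟨h1, by rw [h2, h3]⟩

theorem dense_image_stoneCechUnit {V : Set X} (hV : Dense V) :
    Dense (stoneCechUnit '' V) :=
  denseRange_stoneCechUnit.dense_image continuous_stoneCechUnit hV

/-- The image of `V` is dense in `βX`, and both distances are determined by the same values there.
In particular an extension is unique. -/
theorem Extends.dist_eq {a a' : QFun X} {b b' : QBar X} (h : Extends a b) (h' : Extends a' b') :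
    dist b b' = dist a a' := by
  obtain ⟨V, hV, f, hf, f', hf', G, hG, g, hg, g', hg', rfl, rfl, rfl, rfl, h⟩ :=
    h.exists_common h'
  have key : ∀ ε : ℝ, 0 ≤ ε → (dist (mkOn G hG g hg) (mkOn G hG g' hg') ≤ ε ↔
      dist (mkOn V hV f hf) (mkOn V hV f' hf') ≤ ε) := by
    intro ε hε
    rw [dist_mkOn_le_iff hV.2 subset_rfl hε,
      dist_mkOn_le_iff (dense_image_stoneCechUnit hV.2) (image_subset_iff.2 fun x hx => (h x hx).1)
        hε, forall_mem_image]
    refine forall₂_congr fun x hx => ?_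
    rw [(h x hx).2.1, (h x hx).2.2]
  exact le_antisymm ((key _ dist_nonneg).2 le_rfl) ((key _ dist_nonneg).1 le_rfl)

/-- The image of `V` is dense in `βX` but need not be open there; this is where `G_δ` domains are
needed. -/
theorem exists_extends [T35Space X] (a : QFun X) : ∃ b : QBar X, Extends a b := by
  obtain ⟨V, hV, f, hf, rfl⟩ := exists_eq_mkOn a
  have hj : IsEmbedding (stoneCechUnit : X → StoneCech X) := isEmbedding_stoneCechUnit
  let F : StoneCech X → ℝ := Function.extend stoneCechUnit f 0
  have hF : F ∘ stoneCechUnit = f := Function.extend_comp hj.injective f 0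
  have hFc : ContinuousOn F (stoneCechUnit '' V) := by
    rintro _ ⟨x, hx, rfl⟩
    rw [ContinuousWithinAt, ← hj.isInducing.map_nhdsWithin_eq, Filter.tendsto_map'_iff, hF,
      ← Function.comp_apply (f := F), hF]
    exact hf x hx
  obtain ⟨G, g, hG, hVG, hg, hgF⟩ :=
    exists_extension_isGδ (dense_image_stoneCechUnit hV.2) hFc
  refine ⟨mkOn G ⟨hG, (dense_image_stoneCechUnit hV.2).mono hVG⟩ g hg,
    V, hV, f, hf, G, _, g, hg, rfl, rfl, fun x hx => ⟨hVG ⟨x, hx, rfl⟩, ?_⟩⟩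
  rw [hgF ⟨x, hx, rfl⟩]
  exact congrFun hF x

theorem dense_preimage_stoneCechUnit [T35Space X] {O : Set (StoneCech X)} (hO : IsOpen O)
    (hd : Dense O) : Dense (stoneCechUnit ⁻¹' O : Set X) := by
  have hj : IsInducing (stoneCechUnit : X → StoneCech X) := isEmbedding_stoneCechUnit.isInducing
  refine hj.dense_iff.2 fun x => ?_
  rw [image_preimage_eq_inter_range]
  exact hd.inter_of_isOpen_left denseRange_stoneCechUnit hO _

/-- Functions on dense open sets of `βX` are determined by their restrictions to `X`. -/
theorem exists_extends_of_isOpen [T35Space X] {O : Set (StoneCech X)} (hO : IsOpen O)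
    (hO' : O ∈ (denseGδs (StoneCech X)).sets) {F : StoneCech X → ℝ} (hF : ContinuousOn F O) :
    ∃ a : QFun X, Extends a (mkOn O hO' F hF) :=
  ⟨mkOn (stoneCechUnit ⁻¹' O)
    ⟨hO.preimage continuous_stoneCechUnit, dense_preimage_stoneCechUnit hO hO'.2⟩
    (F ∘ stoneCechUnit) (hF.comp continuous_stoneCechUnit.continuousOn fun _ hx => hx),
    _, _, _, _, _, _, _, _, rfl, rfl, fun _ hx => ⟨hx, rfl⟩⟩

theorem exists_isometry [T35Space X] :
    ∃ ι : QFun X →+* QBar X, Isometry ι ∧ ∀ a b, Extends a b → ι a = b := by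
  choose ι hι using exists_extends (X := X)
  have huniq : ∀ a b, Extends a b → ι a = b := fun a b h =>
    dist_eq_zero.1 (((hι a).dist_eq h).trans (dist_self a))
  have hone : Extends (1 : QFun X) 1 := by
    obtain ⟨V, hV⟩ := (denseOpens X).nonempty
    exact ⟨V, hV, _, _, univ, ⟨IsGδ.univ, dense_univ⟩, _, _, (mkOn_one hV).symm,
      (mkOn_one _).symm, fun x _ => ⟨mem_univ _, rfl⟩⟩
  have hzero : Extends (0 : QFun X) 0 := by
    obtain ⟨V, hV⟩ := (denseOpens X).nonempty
    exact ⟨V, hV, _, _, univ, ⟨IsGδ.univ, dense_univ⟩, _, _, (mkOn_zero hV).symm,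
      (mkOn_zero _).symm, fun x _ => ⟨mem_univ _, rfl⟩⟩
  exact ⟨{ toFun := ι
           map_one' := huniq _ _ hone
           map_zero' := huniq _ _ hzero
           map_add' := fun a b => huniq _ _ ((hι a).add (hι b))
           map_mul' := fun a b => huniq _ _ ((hι a).mul (hι b)) },
    Isometry.of_dist_eq fun a b => (hι a).dist_eq (hι b), huniq⟩

-- On its domain `S` an idempotent takes only the values `0` and `1`. The sets `g > 1/2` and `g <
-- 1/2` are traces of open sets `U` and `V` of `βX`, and the indicator of `U` on `U ∪ V` represents
-- the same element on a dense open set.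
open Classical in
theorem exists_extends_of_idempotent [T35Space X] {b : QBar X} (hb : b * b = b) :
    ∃ a : QFun X, Extends a b := by
  obtain ⟨S, hS, g, hg, rfl⟩ := exists_eq_mkOn b
  obtain ⟨U, hU, hUS⟩ := continuousOn_iff'.1 hg (Ioi (1 / 2)) isOpen_Ioi
  obtain ⟨V, hV, hVS⟩ := continuousOn_iff'.1 hg (Iio (1 / 2)) isOpen_Iio
  -- Disjoint traces on the dense set `S` force the open sets themselves to be disjoint.
  have hUV : Disjoint U V := by
    rw [disjoint_iff_inter_eq_empty, ← not_nonempty_iff_eq_empty]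
    intro hne
    obtain ⟨x, hx, hxS⟩ := hS.2.inter_open_nonempty _ (hU.inter hV) hne
    have h1 : 1 / 2 < g x := (hUS.superset ⟨hx.1, hxS⟩).1
    have h2 : g x < 1 / 2 := (hVS.superset ⟨hx.2, hxS⟩).1
    exact h1.not_gt h2
  have hval : ∀ x ∈ S, (x ∈ U ∧ g x = 1) ∨ (x ∈ V ∧ x ∉ U ∧ g x = 0) := by
    intro x hx
    rcases eq_zero_or_one_of_idempotent hb hx with h | h
    · have hxV : x ∈ V := (hVS.subset ⟨show g x < 1 / 2 by rw [h]; norm_num, hx⟩).1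
      exact Or.inr ⟨hxV, fun hxU => disjoint_left.1 hUV hxU hxV, h⟩
    · exact Or.inl ⟨(hUS.subset ⟨show 1 / 2 < g x by rw [h]; norm_num, hx⟩).1, h⟩
  have hSO : S ⊆ U ∪ V := fun x hx => (hval x hx).imp And.left And.left
  have hO : U ∪ V ∈ (denseGδs (StoneCech X)).sets :=
    ⟨(hU.union hV).isGδ, hS.2.mono hSO⟩
  have hF : ContinuousOn (fun x => if x ∈ U then (1 : ℝ) else 0) (U ∪ V) := by
    have := continuousOn_ite_of_isOpen (S := univ) (f := fun _ => (1 : ℝ)) (g := fun _ => 0)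
      hU hV hUV continuousOn_const continuousOn_const
    rwa [univ_inter] at this
  have heq : mkOn S hS g hg = mkOn (U ∪ V) hO _ hF :=
    mkOn_eq_of_dense hS.2 subset_rfl hSO fun x hx => by
      rcases hval x hx with ⟨h1, h2⟩ | ⟨-, h1, h2⟩ <;> simp [h1, h2]
  rw [heq]
  exact exists_extends_of_isOpen (hU.union hV) hO hF

end Extension

/-! ### Approximation by locally constant functions -/

open Classical in
/-- A continuous function on a dense set can be uniformly approximated by a locally constant
function on a dense open set. -/
theorem exists_isOpen_approx {K : Type*} [TopologicalSpace K] {S : Set K} (hS : Dense S)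
    {g : K → ℝ} (hg : ContinuousOn g S) {δ : ℝ} (hδ : 0 < δ) :
    ∃ (O : Set K) (F : K → ℝ), IsOpen O ∧ Dense O ∧ ContinuousOn F O ∧
      ∀ x ∈ S ∩ O, |g x - F x| ≤ δ := by
  let q := TopologicalSpace.denseSeq ℝ
  have hW := fun n => continuousOn_iff'.1 hg (Metric.ball (q n) δ) Metric.isOpen_ball
  choose W hWo hWS using hW
  -- Removing the closure of the earlier sets, not only their union, keeps the disjoint pieces open;
  -- what is lost is nowhere dense.
  let V : ℕ → Set K := fun n => W n \ closure (⋃ m < n, W m)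
  have hV : ∀ n, IsOpen (V n) := fun n => (hWo n).sdiff isClosed_closure
  have hlt : ∀ m n x, x ∈ V m → x ∈ V n → ¬m < n := fun m n x hm hn hmn =>
    hn.2 (subset_closure (mem_iUnion₂.2 ⟨m, hmn, hm.1⟩))
  have hdisj : ∀ m n x, x ∈ V m → x ∈ V n → m = n := fun m n x hm hn =>
    le_antisymm (not_lt.1 (hlt n m x hn hm)) (not_lt.1 (hlt m n x hm hn))
  let F : K → ℝ := fun x => if h : ∃ n, x ∈ V n then q h.choose else 0
  have hF : ∀ {n x}, x ∈ V n → F x = q n := fun {n x} hx => by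
    have h : ∃ n, x ∈ V n := ⟨n, hx⟩
    have h1 : F x = q h.choose := dif_pos h
    rw [h1, hdisj _ _ x h.choose_spec hx]
  refine ⟨⋃ n, V n, F, isOpen_iUnion hV, ?_, ?_, ?_⟩
  · rw [dense_iff_inter_open]
    intro U hU hne
    have hex : ∃ n, (U ∩ W n).Nonempty := by
      obtain ⟨x, hx, hxS⟩ := hS.inter_open_nonempty U hU hne
      obtain ⟨n, hn⟩ := (TopologicalSpace.denseRange_denseSeq ℝ).exists_dist_lt (g x) hδ
      exact ⟨n, x, hx, ((hWS n).subset ⟨hn, hxS⟩).1⟩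
    -- For the least `n` with `W n` meeting `U`, the open set `U` misses all earlier `W m`, hence
    -- also the closure of their union.
    obtain ⟨x, hxU, hxW⟩ := Nat.find_spec hex
    refine ⟨x, hxU, mem_iUnion.2 ⟨Nat.find hex, hxW, fun hx => ?_⟩⟩
    obtain ⟨y, hyU, hy⟩ := mem_closure_iff.1 hx U hU hxU
    obtain ⟨m, hm, hym⟩ := mem_iUnion₂.1 hy
    exact Nat.find_min hex hm ⟨y, hyU, hym⟩
  · intro x hx
    obtain ⟨n, hn⟩ := mem_iUnion.1 hx
    refine ((continuousAt_const (y := q n)).congr ?_).continuousWithinAt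
    filter_upwards [(hV n).mem_nhds hn] with y hy
    exact (hF hy).symm
  · rintro x ⟨hxS, hx⟩
    obtain ⟨n, hn⟩ := mem_iUnion.1 hx
    rw [hF hn]
    have h1 : dist (g x) (q n) < δ := ((hWS n).superset ⟨hn.1, hxS⟩).1
    exact h1.le

section Approximation

open DenseFilterBase

variable {X : Type u} [TopologicalSpace X]

theorem frac_le_abs (t : ℝ) : |t| / (1 + |t|) ≤ |t| :=
  div_le_self (abs_nonneg t) (by linarith [abs_nonneg t])

/-- The locally constant approximation lives on a dense open set of `βX`, so it restricts to a dense
open set of `X`. This gives the density of `QFun X` in `QBar X`. -/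
theorem exists_extends_dist_le [T35Space X] (b : QBar X) {ε : ℝ} (hε : 0 < ε) :
    ∃ (a : QFun X) (b' : QBar X), Extends a b' ∧ dist b b' ≤ ε := by
  obtain ⟨S, hS, g, hg, rfl⟩ := exists_eq_mkOn b
  obtain ⟨O, F, hO, hOd, hF, h⟩ := exists_isOpen_approx hS.2 hg hε
  have hO' : O ∈ (denseGδs (StoneCech X)).sets := ⟨hO.isGδ, hOd⟩
  obtain ⟨a, ha⟩ := exists_extends_of_isOpen hO hO' hF
  refine ⟨a, _, ha, ?_⟩
  have hSO := DenseFilterBase.inter _ S hS O hO'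
  rw [mkOn_mono hSO inter_subset_left hg, mkOn_mono hSO inter_subset_right hF,
    dist_mkOn_le_iff hSO.2 subset_rfl hε.le]
  exact fun x hx => (frac_le_abs _).trans (h x hx)

/-! ### Completeness -/

theorem abs_le_of_frac_le {t ε : ℝ} (hε : 0 < ε) (h : |t| / (1 + |t|) ≤ ε / (1 + ε)) :
    |t| ≤ ε := by
  rw [div_le_div_iff₀ (by positivity) (by positivity)] at h
  linarith

/-- Closure under countable intersections gives all terms of a Cauchy sequence one common domain, on
which they converge uniformly to a continuous limit. -/
theorem completeSpace_funRing (𝒮 : DenseFilterBase X)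
    (h𝒮 : ∀ S : ℕ → Set X, (∀ n, S n ∈ 𝒮.sets) → ⋂ n, S n ∈ 𝒮.sets) :
    CompleteSpace 𝒮.FunRing := by
  refine Metric.complete_of_cauchySeq_tendsto fun u hu => ?_
  choose S hS f hf hfu using fun n => exists_eq_mkOn (u n)
  have hT := h𝒮 S hS
  have hfc : ∀ n, ContinuousOn (f n) (⋂ n, S n) := fun n => (hf n).mono (iInter_subset S n)
  have hfT : ∀ n, u n = mkOn _ hT (f n) (hfc n) := fun n =>
    (hfu n).trans (mkOn_mono hT (iInter_subset S n) (hf n))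
  have hd : Dense (⋂ n, S n) := 𝒮.dense _ hT
  have hcau : UniformCauchySeqOn f Filter.atTop (⋂ n, S n) := by
    rw [Metric.uniformCauchySeqOn_iff]
    intro ε hε
    -- The map `t ↦ t / (1 + t)` is increasing, so this bound on the metric means a uniform bound `ε
    -- / 2`; the half yields a strict inequality.
    obtain ⟨N, hN⟩ := Metric.cauchySeq_iff.1 hu (ε / 2 / (1 + ε / 2)) (by positivity)
    refine ⟨N, fun m hm n hn x hx => ?_⟩
    have h1 := (hN m hm n hn).le
    rw [hfT m, hfT n, dist_mkOn_le_iff hd subset_rfl (by positivity)] at h1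
    have h2 := abs_le_of_frac_le (half_pos hε) (h1 x hx)
    rw [Real.dist_eq]
    linarith
  have hlim : ∀ x ∈ ⋂ n, S n, ∃ y, Filter.Tendsto (fun n => f n x) Filter.atTop (𝓝 y) :=
    fun x hx => cauchySeq_tendsto_of_complete (hcau.cauchy_map hx)
  choose! F hF using hlim
  have hunif := hcau.tendstoUniformlyOn_of_tendsto hF
  have hFc : ContinuousOn F (⋂ n, S n) :=
    hunif.continuousOn (Filter.Eventually.of_forall hfc).frequently
  refine ⟨mkOn _ hT F hFc, Metric.tendsto_atTop.2 fun ε hε => ?_⟩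
  obtain ⟨N, hN⟩ := Filter.eventually_atTop.1
    (Metric.tendstoUniformlyOn_iff.1 hunif _ (half_pos hε))
  refine ⟨N, fun n hn => lt_of_le_of_lt ?_ (half_lt_self hε)⟩
  rw [hfT n, dist_mkOn_le_iff hd subset_rfl (half_pos hε).le]
  intro x hx
  have h1 := hN n hn x hx
  rw [dist_comm, Real.dist_eq] at h1
  exact (frac_le_abs _).trans h1.le

theorem denseGδs_iInter_mem [BaireSpace X] (S : ℕ → Set X) (hS : ∀ n, S n ∈ (denseGδs X).sets) :
    ⋂ n, S n ∈ (denseGδs X).sets :=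
  ⟨IsGδ.iInter fun n => (hS n).1, dense_iInter_of_Gδ (fun n => (hS n).1) fun n => (hS n).2⟩

end Approximation

end RingsOfQuotients

end

/-! ### The main theorem -/

open RingsOfQuotients DenseFilterBase in
theorem mainTheorem8 (X : Type*) [TopologicalSpace X] [T35Space X] :
    -- `QFun X` is the maximal ring of quotients of `C(X)`
    Nonempty (RingsOfQuotients.Q X ≃ₐ[C(X, ℝ)] RingsOfQuotients.QFun X) ∧
    -- `QBar X` is the metric completion of `QFun X`
    (CompleteSpace (RingsOfQuotients.QBar X) ∧
      ∃ ι : RingsOfQuotients.QFun X →+* RingsOfQuotients.QBar X, Isometry ι ∧ DenseRange ι) ∧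
    -- the maximal ideal spaces are homeomorphic
    Nonempty (MaximalSpectrum (RingsOfQuotients.Q X) ≃ₜ
      MaximalSpectrum (RingsOfQuotients.QStar X)) ∧
    Nonempty (MaximalSpectrum (RingsOfQuotients.Q X) ≃ₜ
      MaximalSpectrum (RingsOfQuotients.QBar X)) ∧
    Nonempty (MaximalSpectrum (RingsOfQuotients.Q X) ≃ₜ
      MaximalSpectrum (RingsOfQuotients.QBarStar X)) ∧
    Nonempty (MaximalSpectrum (RingsOfQuotients.Q X) ≃ₜ
      MaximalSpectrum (RingsOfQuotients.IdempotentRing (RingsOfQuotients.Q X))) := by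
  obtain ⟨ψ⟩ := nonempty_algEquiv_QFun X
  obtain ⟨ι, hι, hext⟩ := exists_isometry (X := X)
  have hopen : ∀ U, IsOpen U → Dense U → U ∈ (denseOpens X).sets := fun U h h' => ⟨h, h'⟩
  have hGδ : ∀ U, IsOpen U → Dense U → U ∈ (denseGδs (StoneCech X)).sets :=
    fun U h h' => ⟨h.isGδ, h'⟩
  -- In each case the Boolean ring is the one of idempotents of `Q X`; only the target ring changes.
  have h1 := isIdempotentIso_comp (RingHom.id (Q X)) Function.injective_id
    fun r _ => ⟨r, rfl⟩
  have h2 := isIdempotentIso_comp (ψ.toRingEquiv : Q X →+* QFun X) ψ.injective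
    fun r _ => ψ.surjective r
  have h3 := isIdempotentIso_comp (ι.comp (ψ.toRingEquiv : Q X →+* QFun X))
    (hι.injective.comp ψ.injective) fun r hr => by
      obtain ⟨a, ha⟩ := exists_extends_of_idempotent hr
      obtain ⟨b, rfl⟩ := ψ.surjective a
      exact ⟨b, hext _ _ ha⟩
  have e1 := h1.maximalSpectrumHomeomorph
    ((isExchangeRing hopen).of_ringEquiv ψ.toRingEquiv)
  have e2 := (h2.codRestrict (QStar X) fun _ => mem_bounded_of_idempotent).maximalSpectrumHomeomorph
    (isExchangeRing_bounded hopen)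
  have e3 := h3.maximalSpectrumHomeomorph (isExchangeRing hGδ)
  have e4 := (h3.codRestrict (QBarStar X) fun _ =>
    mem_bounded_of_idempotent).maximalSpectrumHomeomorph (isExchangeRing_bounded hGδ)
  refine ⟨⟨ψ⟩, ⟨completeSpace_funRing _ denseGδs_iInter_mem, ι, hι, fun b => ?_⟩,
    ⟨e1.trans e2.symm⟩, ⟨e1.trans e3.symm⟩, ⟨e1.trans e4.symm⟩, ⟨e1⟩⟩
  rw [Metric.mem_closure_iff]
  intro ε hε
  obtain ⟨a, b', ha, h⟩ := exists_extends_dist_le b (half_pos hε)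
  exact ⟨b', ⟨a, hext _ _ ha⟩, h.trans_lt (half_lt_self hε)⟩
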